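/- All posets are finite. A (Hasse) diagram of a poset $P$ represents distinct elements of $P$ by distinct points of the plane and every covering $a\prec b$ by the straight line segment joining the two points, $b$ being higher than $a$; no such edge passes through a point representing a third element. A diagram is planar if distinct edges have no common point except possibly endpoints. In a diagram of a bounded poset every maximal chain $C$ is drawn as a polygonal line from $0$ to $1$, which has a left side and a right side (both containing $C$). For $x,y$ in such a diagram write $x\mathrel{\lambda}y$ ("$x$ is on the left of $y$") if $x$ and $y$ are incomparable and $x$ is on the left side of some maximal chain through $y$; "$x$ is on the right of $y$" is defined analogously. A quasiplanar diagram is a diagram of a bounded poset with $0\ne 1$ such that (i) whenever $x\mathrel{\lambda}y$, then $x$ is on the left side of every maximal chain through $y$, and (ii) $x\mathrel{\lambda}y$ if and only if $y$ is on the right of $x$. A slim semimodular lattice diagram is a planar diagram of a finite (nonempty) semimodular lattice whose join-irreducible elements are contained in the union of two chains. Two diagrams are similar if there is an order isomorphism between them that preserves $\lambda$ in both directions. For a slim semimodular lattice diagram $D$, let $\alpha(D)$ be the quasiplanar diagram (unique up to similarity) consisting of the meet-irreducible elements of $D$, the element $1$ of $D$, and a new bottom element, with the order and the relation $\lambda$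 inherited from $D$. For a quasiplanar diagram $Q$, let $Q^+=Q\setminus\{0\}$. * $\beta_1(Q)$ is the planar diagram (unique up to similarity) of the poset of all pairs $(x,y)\in Q^+\times Q^+$ with $x=y$ or $x\mathrel{\lambda}y$, where $(x_1,y_1)\le(x_2,y_2)$ means that ($x_1\le x_2$ or $x_1\mathrel{\lambda}x_2$) and ($y_2\ge y_1$ or $y_2\mathrel{\lambda}y_1$), in which $(x_1,y_1)\mathrel{\lambda}(x_2,y_2)$ if and only if ($x_1<x_2$ or $x_1\mathrel{\lambda}x_2$) and ($y_1>y_2$ or $y_1\mathrel{\lambda}y_2$). * $\beta_2(Q)$ is the planar diagram (unique up to similarity) of the set of all nonempty up-sets $X\subseteq Q^+$ such that $x\mathrel{\lambda}y\mathrel{\lambda}z$ and $x,z\in X$ imply $y\in X$, ordered by reverse inclusion, whose leftmost maximal chain is $\{F_0,F_1,\dots,F_{|Q|-2}\}$ and whose rightmost maximal chain is $\{G_0,G_1,\dots,G_{|Q|-2}\}$. Here $F_0=G_0=\{1\}$, $F_{n+1}=F_n\cup\{f_n\}$ with $f_n$ the leftmost maximal element of $Q\setminus F_n$, and $G_{n+1}=G_n\cup\{g_n\}$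 with $g_n$ the rightmost maximal element of $Q\setminus G_n$. **Theorem.** Let $D$ be a finite slim semimodular lattice diagram, let $Q$ be a finite quasiplanar diagram, and let $p\in\{1,2\}$. Then: (a) $\alpha(D)$ exists and is a finite quasiplanar diagram; (b) $\beta_p(Q)$ exists and is a finite slim semimodular lattice diagram; (c) $\beta_p(\alpha(D))$ is similar to $D$; (d) $\alpha(\beta_p(Q))$ is similar to $Q$. Consequently $\alpha$ and $\beta_p$ induce mutually inverse bijections between the similarity classes of finite slim semimodular lattice diagrams and the similarity classes of finite quasiplanar diagrams. -/

import Mathlib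

universe u

/-- A (Hasse) diagram of a poset `P`: every element is represented by a point of the plane, and
every covering pair `a ⋖ b` by the straight line segment joining the two points, with `b` drawn
higher than `a`. Different elements are different points, and no edge passes through a point that
represents an element other than its endpoints. -/
structure HasseDiagram (P : Type u) [PartialOrder P] where
  /-- The point representing an element; the second coordinate is its height. -/
  pos : P → ℝ × ℝ
  pos_injective : Function.Injective pos
  height_lt : ∀ a b : P, a ⋖ b → (pos a).2 < (pos b).2
  vertex_notMem_edge : ∀ a b c : P, a ⋖ b → pos c ∉ openSegment ℝ (pos a) (pos b)

namespace HasseDiagram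

variable {P : Type u} [PartialOrder P] (d : HasseDiagram P)

/-- Two different edges have no point in common, except possibly endpoints. -/
def IsPlanar : Prop :=
  ∀ a b a' b' : P, a ⋖ b → a' ⋖ b' → (a, b) ≠ (a', b') →
    Disjoint (openSegment ℝ (d.pos a) (d.pos b)) (openSegment ℝ (d.pos a') (d.pos b'))

/-- The polygonal line drawn by a maximal chain `C`: its points and the edges joining them. -/
def chainCurve (C : Set P) : Set (ℝ × ℝ) :=
  d.pos '' C ∪ {z | ∃ a ∈ C, ∃ b ∈ C, a ⋖ b ∧ z ∈ segment ℝ (d.pos a) (d.pos b)}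

/-- `x` is on the left side of the chain `C` (the chain itself belongs to its left side): the point
of the polygonal line of `C` at the height of `x` is not to the left of `x`. -/
def OnLeft (x : P) (C : Set P) : Prop :=
  ∃ z ∈ d.chainCurve C, z.2 = (d.pos x).2 ∧ (d.pos x).1 ≤ z.1

/-- `x` is on the right side of the chain `C` (the chain itself belongs to its right side). -/
def OnRight (x : P) (C : Set P) : Prop :=
  ∃ z ∈ d.chainCurve C, z.2 = (d.pos x).2 ∧ z.1 ≤ (d.pos x).1

/-- `x` is on the left of `y`: they are incomparable and `x` is on the left of some maximal chain
through `y`. -/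
def Lft (x y : P) : Prop :=
  ¬ x ≤ y ∧ ¬ y ≤ x ∧ ∃ C : Set P, IsMaxChain (· ≤ ·) C ∧ y ∈ C ∧ d.OnLeft x C

/-- `x` is on the right of `y`: they are incomparable and `x` is on the right of some maximal chain
through `y`. -/
def Rght (x y : P) : Prop :=
  ¬ x ≤ y ∧ ¬ y ≤ x ∧ ∃ C : Set P, IsMaxChain (· ≤ ·) C ∧ y ∈ C ∧ d.OnRight x C

/-- The condition of quasiplanarity on a diagram of a bounded poset: if `x` is on the left of some
maximal chain through the incomparable element `y`, then it is on the left of every such chain;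
and "on the left of" and "on the right of" are converse relations. -/
structure IsQuasiplanar [BoundedOrder P] : Prop where
  left_of_every : ∀ x y : P, d.Lft x y → ∀ C : Set P, IsMaxChain (· ≤ ·) C → y ∈ C → d.OnLeft x C
  lft_iff_rght : ∀ x y : P, d.Lft x y ↔ d.Rght y x

/-- `C` is the leftmost maximal chain (the left boundary chain). -/
def IsLeftBoundary (C : Set P) : Prop :=
  IsMaxChain (· ≤ ·) C ∧ ∀ E : Set P, IsMaxChain (· ≤ ·) E → ∀ x ∈ C, d.OnLeft x E

/-- `C` is the rightmost maximal chain (the right boundary chain). -/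
def IsRightBoundary (C : Set P) : Prop :=
  IsMaxChain (· ≤ ·) C ∧ ∀ E : Set P, IsMaxChain (· ≤ ·) E → ∀ x ∈ C, d.OnRight x E

/-- `ψ` is a similarity map: an order isomorphism preserving "on the left of" both ways. -/
def IsSimilarity {P' : Type u} [PartialOrder P'] (d : HasseDiagram P) (d' : HasseDiagram P')
    (ψ : P ≃o P') : Prop :=
  ∀ x y : P, d.Lft x y ↔ d'.Lft (ψ x) (ψ y)

end HasseDiagram

/-- A lattice is slim if its join-irreducible elements are covered by two chains. -/
def IsSlim (L : Type u) [Lattice L] : Prop :=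
  ∃ C₁ C₂ : Set L, IsChain (· ≤ ·) C₁ ∧ IsChain (· ≤ ·) C₂ ∧ {x : L | SupIrred x} ⊆ C₁ ∪ C₂

/-- Finite quasiplanar diagrams (of bounded posets, with `0 ≠ 1`). -/
structure QuasiplanarDiagram : Type (u + 1) where
  carrier : Type u
  [partialOrder : PartialOrder carrier]
  [boundedOrder : BoundedOrder carrier]
  [finite : Finite carrier]
  [nontrivial : Nontrivial carrier]
  diagram : HasseDiagram carrier
  isQuasiplanar : diagram.IsQuasiplanar

attribute [instance] QuasiplanarDiagram.partialOrder QuasiplanarDiagram.boundedOrder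
attribute [instance] QuasiplanarDiagram.finite QuasiplanarDiagram.nontrivial

/-- Finite slim semimodular lattice diagrams: planar diagrams of finite slim semimodular lattices
(`IsUpperModularLattice` is semimodularity: `a ⊓ b ⋖ a` implies `b ⋖ a ⊔ b`). -/
structure SlimSemimodularDiagram : Type (u + 1) where
  carrier : Type u
  [lattice : Lattice carrier]
  [finite : Finite carrier]
  [nonempty : Nonempty carrier]
  diagram : HasseDiagram carrier
  isPlanar : diagram.IsPlanar
  isSlim : IsSlim carrier
  semimodular : IsUpperModularLattice carrier

attribute [instance] SlimSemimodularDiagram.lattice SlimSemimodularDiagram.finite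
attribute [instance] SlimSemimodularDiagram.nonempty

namespace QuasiplanarDiagram

/-- Similarity of quasiplanar diagrams, as an equivalence relation. -/
def similar : Setoid QuasiplanarDiagram.{u} where
  r Q Q' := ∃ ψ : Q.carrier ≃o Q'.carrier, Q.diagram.IsSimilarity Q'.diagram ψ
  iseqv :=
    { refl := fun Q => ⟨OrderIso.refl _, fun _ _ => Iff.rfl⟩
      symm := by
        rintro Q Q' ⟨ψ, h⟩
        refine ⟨ψ.symm, fun x y => ?_⟩
        rw [h (ψ.symm x) (ψ.symm y), ψ.apply_symm_apply, ψ.apply_symm_apply]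
      trans := by
        rintro Q Q' Q'' ⟨ψ, h⟩ ⟨χ, k⟩
        exact ⟨ψ.trans χ, fun x y => (h x y).trans (k _ _)⟩ }

variable (Q : QuasiplanarDiagram.{u})

/-- The set of pairs `(x, y)` of nonzero elements such that `x = y` or `x` is on the left of `y`. -/
def LeftPair : Type u :=
  {s : Q.carrier × Q.carrier // s.1 ≠ ⊥ ∧ s.2 ≠ ⊥ ∧ (s.1 = s.2 ∨ Q.diagram.Lft s.1 s.2)}

/-- The order of left pairs. -/
def LeftPair.le {Q : QuasiplanarDiagram.{u}} (s t : LeftPair Q) : Prop :=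
  (s.1.1 ≤ t.1.1 ∨ Q.diagram.Lft s.1.1 t.1.1) ∧ (s.1.2 ≤ t.1.2 ∨ Q.diagram.Lft t.1.2 s.1.2)

/-- The "on the left of" relation of left pairs. -/
def LeftPair.lft {Q : QuasiplanarDiagram.{u}} (s t : LeftPair Q) : Prop :=
  (s.1.1 < t.1.1 ∨ Q.diagram.Lft s.1.1 t.1.1) ∧ (t.1.2 < s.1.2 ∨ Q.diagram.Lft s.1.2 t.1.2)

/-- Proper horizontally convex order filters. -/
structure IsHcoFilter (X : Set Q.carrier) : Prop where
  nonempty : X.Nonempty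
  bot_notMem : ⊥ ∉ X
  isUpperSet : IsUpperSet X
  horizontallyConvex : ∀ x y z : Q.carrier,
    Q.diagram.Lft x y → Q.diagram.Lft y z → x ∈ X → z ∈ X → y ∈ X

/-- The set of the proper horizontally convex order filters. -/
def HcoFilter : Type u := {X : Set Q.carrier // Q.IsHcoFilter X}

/-- The members of the sequence `F₀ = {1}`, `Fₙ₊₁ = Fₙ ∪ {fₙ}`, where `fₙ` is the leftmost one of
the maximal elements outside `Fₙ`, continued as long as some nonzero element is outside `Fₙ`. -/
inductive LeftSeq : Set Q.carrier → Prop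
  | base : LeftSeq {⊤}
  | step (F : Set Q.carrier) (f : Q.carrier) : LeftSeq F → (∃ x, x ≠ ⊥ ∧ x ∉ F) →
      Maximal (· ∉ F) f → (∀ y, Maximal (· ∉ F) y → y ≠ f → Q.diagram.Lft f y) →
      LeftSeq (insert f F)

/-- The left-right dual: the members of the sequence `G₀ = {1}`, `Gₙ₊₁ = Gₙ ∪ {gₙ}`, where `gₙ` is
the rightmost one of the maximal elements outside `Gₙ`. -/
inductive RightSeq : Set Q.carrier → Prop
  | base : RightSeq {⊤}
  | step (G : Set Q.carrier) (g : Q.carrier) : RightSeq G → (∃ x, x ≠ ⊥ ∧ x ∉ G) →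
      Maximal (· ∉ G) g → (∀ y, Maximal (· ∉ G) y → y ≠ g → Q.diagram.Rght g y) →
      RightSeq (insert g G)

end QuasiplanarDiagram

namespace SlimSemimodularDiagram

/-- Similarity of slim semimodular lattice diagrams, as an equivalence relation. -/
def similar : Setoid SlimSemimodularDiagram.{u} where
  r D D' := ∃ ψ : D.carrier ≃o D'.carrier, D.diagram.IsSimilarity D'.diagram ψ
  iseqv :=
    { refl := fun D => ⟨OrderIso.refl _, fun _ _ => Iff.rfl⟩
      symm := by
        rintro D D' ⟨ψ, h⟩
        refine ⟨ψ.symm, fun x y => ?_⟩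
        rw [h (ψ.symm x) (ψ.symm y), ψ.apply_symm_apply, ψ.apply_symm_apply]
      trans := by
        rintro D D' D'' ⟨ψ, h⟩ ⟨χ, k⟩
        exact ⟨ψ.trans χ, fun x y => (h x y).trans (k _ _)⟩ }

variable (D : SlimSemimodularDiagram.{u})

/-- The meet-irreducible elements and the top element, with the inherited order. -/
abbrev MirTop : Type u := {x : D.carrier // InfIrred x ∨ IsTop x}

/-- `Q` is, up to similarity, the diagram `α(D)`: its poset is that of the meet-irreducible
elements of `D`, the top of `D` and a new bottom element, and for elements `x`, `y` of `D` in it,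
`x` is on the left of `y` in `Q` if and only if it is in `D`. -/
def IsAlpha (Q : QuasiplanarDiagram.{u}) : Prop :=
  ∃ e : WithBot D.MirTop ≃o Q.carrier,
    ∀ x y : D.MirTop, Q.diagram.Lft (e x) (e y) ↔ D.diagram.Lft x.1 y.1

end SlimSemimodularDiagram

namespace QuasiplanarDiagram

variable (Q : QuasiplanarDiagram.{u})

/-- `D` is, up to similarity, the diagram `β₁(Q)`: it is a planar diagram of the poset of left
pairs whose "on the left of" relation is that of left pairs. -/
def IsBetaOne (D : SlimSemimodularDiagram.{u}) : Prop :=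
  ∃ e : D.carrier ≃ LeftPair Q,
    (∀ s t : D.carrier, s ≤ t ↔ (e s).le (e t)) ∧
    (∀ s t : D.carrier, D.diagram.Lft s t ↔ (e s).lft (e t))

/-- `D` is, up to similarity, the diagram `β₂(Q)`: it is a planar diagram of the lattice of proper
horizontally convex order filters, ordered by reverse inclusion, and the members of the two
sequences of filters form its left boundary chain and its right boundary chain. -/
def IsBetaTwo (D : SlimSemimodularDiagram.{u}) : Prop :=
  ∃ e : D.carrier ≃ HcoFilter Q,
    (∀ s t : D.carrier, s ≤ t ↔ (e t).1 ⊆ (e s).1) ∧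
    (∃ C : Set D.carrier, D.diagram.IsLeftBoundary C ∧
      (fun s => (e s).1) '' C = {X | Q.LeftSeq X}) ∧
    (∃ C : Set D.carrier, D.diagram.IsRightBoundary C ∧
      (fun s => (e s).1) '' C = {X | Q.RightSeq X})

end QuasiplanarDiagram

/-! The drawings are replaced by combinatorics. In a quasiplanar diagram λ is transitive, hence a
strict order relating exactly the incomparable pairs. Then ≤ ∪ λ and ≤ ∪ λ⁻¹ are linear orders whose
intersection is ≤. Conversely, every such λ on a finite bounded poset is realized by a quasiplanar
diagram with the ranks in the two linear orders as coordinates, turned by 45 degrees; if the poset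
is a lattice, this drawing is planar. Planar diagrams of bounded posets are quasiplanar, since
maximal chains through incomparable elements cannot meet between their heights. So, up to
similarity, both kinds of diagram are posets with a conjugate relation (`IsConjugate`).

Given Q, a left pair (x, y) corresponds to the set of elements that are at least x in the first
linear order and at least y in the second. These sets are exactly the proper horizontally convex
filters, and x, y are recovered as the two least elements. Hence joins are intersections and meets
are componentwise minima. A covering changes the filter by one element, which gives semimodularity;
filters that are final segments of one of the linear orders form two chains containing the
join-irreducibles, which gives slimness; the meet-irreducibles and the top are the diagonal pairs,
which gives back Q.

Given D, an element d is sent to the filter of meet-irreducibles above it. The crux is that a pair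
(m, m') is attained at m ⊓ m'. It rests on `IsSlim.infIrred_unique`: passing from d to an upper
cover loses at most one meet-irreducible.

For β₂, the left boundary chain consists of the final segments of one linear order, and this
determines λ. Thus `IsAlpha`, `IsBetaOne` and `IsBetaTwo` are one and the same relation between
diagrams, and its existence and uniqueness on both sides give everything. -/

/-! ### Conjugate relations and their two linear orders -/

/-- A relation on a poset that is a strict order comparing exactly the incomparable pairs. -/
structure IsConjugate {P : Type*} [PartialOrder P] (r : P → P → Prop) : Prop where
  incomp : ∀ {x y : P}, r x y → ¬ x ≤ y ∧ ¬ y ≤ x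
  total : ∀ {x y : P}, ¬ x ≤ y → ¬ y ≤ x → r x y ∨ r y x
  trans : ∀ {x y z : P}, r x y → r y z → r x z

/-- The linear order obtained from a conjugate relation by joining it to the order. -/
def leftLE {P : Type*} [PartialOrder P] (r : P → P → Prop) (x y : P) : Prop := x ≤ y ∨ r x y

namespace IsConjugate

variable {P : Type*} [PartialOrder P] {r : P → P → Prop}

theorem asymm (h : IsConjugate r) {x y : P} (hxy : r x y) : ¬ r y x :=
  fun hyx => (h.incomp (h.trans hxy hyx)).1 le_rfl

theorem swap (h : IsConjugate r) : IsConjugate (Function.swap r) where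
  incomp hxy := (h.incomp hxy).symm
  total h₁ h₂ := h.total h₂ h₁
  trans h₁ h₂ := h.trans h₂ h₁

theorem le_refl (r : P → P → Prop) (x : P) : leftLE r x x := Or.inl le_rfl

/-- In the mixed cases the outer elements, if incomparable, are related in one direction; the wrong
direction composes with the given relation to relate two comparable elements. -/
theorem le_trans (h : IsConjugate r) {x y z : P} (hxy : leftLE r x y) (hyz : leftLE r y z) :
    leftLE r x z := by
  by_cases hxz : x ≤ z
  · exact Or.inl hxz
  refine Or.inr ?_
  rcases hxy with hxy | hxy <;> rcases hyz with hyz | hyz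
  · exact absurd (hxy.trans hyz) hxz
  · have hzx : ¬ z ≤ x := fun hzx => (h.incomp hyz).2 (hzx.trans hxy)
    rcases h.total hxz hzx with h' | h'
    · exact h'
    · exact absurd hxy (h.incomp (h.trans hyz h')).2
  · have hzx : ¬ z ≤ x := fun hzx => (h.incomp hxy).2 (hyz.trans hzx)
    rcases h.total hxz hzx with h' | h'
    · exact h'
    · exact absurd hyz (h.incomp (h.trans h' hxy)).2
  · exact h.trans hxy hyz

theorem le_antisymm (h : IsConjugate r) {x y : P} (hxy : leftLE r x y) (hyx : leftLE r y x) :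
    x = y := by
  rcases hxy with hxy | hxy <;> rcases hyx with hyx | hyx
  · exact _root_.le_antisymm hxy hyx
  · exact absurd hxy (h.incomp hyx).2
  · exact absurd hyx (h.incomp hxy).2
  · exact absurd hyx (h.asymm hxy)

theorem le_total (h : IsConjugate r) (x y : P) : leftLE r x y ∨ leftLE r y x := by
  by_cases hxy : x ≤ y
  · exact Or.inl (Or.inl hxy)
  by_cases hyx : y ≤ x
  · exact Or.inr (Or.inl hyx)
  exact (h.total hxy hyx).imp Or.inr Or.inr

theorem le_iff (h : IsConjugate r) {x y : P} :
    x ≤ y ↔ leftLE r x y ∧ leftLE (Function.swap r) x y := by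
  refine ⟨fun hxy => ⟨Or.inl hxy, Or.inl hxy⟩, ?_⟩
  rintro ⟨hxy | hxy, hyx | hyx⟩
  · exact hxy
  · exact hxy
  · exact hyx
  · exact absurd hyx (h.asymm hxy)

theorem rel_iff (h : IsConjugate r) {x y : P} :
    r x y ↔ x ≠ y ∧ leftLE r x y ∧ leftLE (Function.swap r) y x := by
  refine ⟨fun hxy => ⟨?_, Or.inr hxy, Or.inr hxy⟩, ?_⟩
  · rintro rfl
    exact (h.incomp hxy).1 le_rfl
  · rintro ⟨hne, hxy | hxy, hyx | hyx⟩
    · exact absurd (_root_.le_antisymm hxy hyx) hne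
    · exact hyx
    · exact hxy
    · exact hxy

theorem not_le_iff (h : IsConjugate r) {x y : P} : ¬ leftLE r x y ↔ leftLE r y x ∧ x ≠ y := by
  constructor
  · intro hxy
    refine ⟨(h.le_total x y).resolve_left hxy, ?_⟩
    rintro rfl
    exact hxy (le_refl r x)
  · rintro ⟨hyx, hne⟩ hxy
    exact hne (h.le_antisymm hxy hyx)

/-- An element between two elements in the sense of the conjugate relation is above all their
common lower bounds. -/
theorem le_of_between (h : IsConjugate r) {w x y z : P} (hwx : w ≤ x) (hwy : w ≤ y)
    (hxz : leftLE r x z) (hyz : leftLE (Function.swap r) y z) : w ≤ z :=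
  h.le_iff.2 ⟨h.le_trans (Or.inl hwx) hxz, h.swap.le_trans (Or.inl hwy) hyz⟩

theorem exists_least [Finite P] (h : IsConjugate r) {A : Set P} (hA : A.Nonempty) :
    ∃ a ∈ A, ∀ b ∈ A, leftLE r a b := by
  have : IsTrans P fun x y => leftLE r x y ∧ x ≠ y :=
    ⟨fun x y z hxy hyz => ⟨h.le_trans hxy.1 hyz.1, by
      rintro rfl
      exact hxy.2 (h.le_antisymm hxy.1 hyz.1)⟩⟩
  have : Std.Irrefl fun x y : P => leftLE r x y ∧ x ≠ y := ⟨fun x hx => hx.2 rfl⟩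
  have wf : WellFounded fun x y : P => leftLE r x y ∧ x ≠ y :=
    Finite.wellFounded_of_trans_of_irrefl _
  obtain ⟨a, ha, hmin⟩ := wf.has_min A hA
  refine ⟨a, ha, fun b hb => ?_⟩
  by_contra hab
  exact hmin b hb ⟨(h.not_le_iff.1 hab).1, (h.not_le_iff.1 hab).2.symm⟩

/-- The number of elements strictly before `x`. -/
noncomputable def rank (r : P → P → Prop) (x : P) : ℕ := {y | leftLE r y x ∧ y ≠ x}.ncard

theorem rank_lt_rank [Finite P] (h : IsConjugate r) {x y : P} (hxy : leftLE r x y) (hne : x ≠ y) :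
    rank r x < rank r y := by
  refine Set.ncard_lt_ncard ⟨fun z hz => ⟨h.le_trans hz.1 hxy, ?_⟩, fun hsub => ?_⟩
    (Set.toFinite _)
  · rintro rfl
    exact hz.2 (h.le_antisymm hz.1 hxy)
  · exact (hsub (⟨hxy, hne⟩ : x ∈ {z | leftLE r z y ∧ z ≠ y})).2 rfl

theorem rank_le_rank [Finite P] (h : IsConjugate r) {x y : P} :
    rank r x ≤ rank r y ↔ leftLE r x y := by
  constructor
  · intro hle
    by_contra hxy
    obtain ⟨h₁, h₂⟩ := h.not_le_iff.1 hxy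
    exact absurd hle (not_le.2 (h.rank_lt_rank h₁ h₂.symm))
  · intro hxy
    by_cases hne : x = y
    · rw [hne]
    · exact (h.rank_lt_rank hxy hne).le

end IsConjugate

/-! ### Maximal chains as curves in the plane -/

namespace HasseDiagram

variable {P : Type*} [PartialOrder P] (d : HasseDiagram P)

theorem height_strictMono [Finite P] : StrictMono fun x => (d.pos x).2 := by
  intro a b hab
  have := Fintype.ofFinite P
  classical
  have := Fintype.toLocallyFiniteOrder (α := P)
  have hab' := transGen_covBy_of_lt hab
  clear hab
  induction hab' with
  | single h => exact d.height_lt _ _ h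
  | tail _ h ih => exact ih.trans (d.height_lt _ _ h)

theorem exists_isMaxChain_mem (y : P) : ∃ C : Set P, IsMaxChain (· ≤ ·) C ∧ y ∈ C := by
  obtain ⟨C, hC, hy⟩ := (Set.subsingleton_singleton (a := y)).isChain (r := (· ≤ ·)).exists_maxChain
  exact ⟨C, hC, hy rfl⟩

theorem exists_isMaxChain_mem_mem {x y : P} (hxy : x ≤ y) :
    ∃ C : Set P, IsMaxChain (· ≤ ·) C ∧ x ∈ C ∧ y ∈ C := by
  obtain ⟨C, hC, hy⟩ := (IsChain.pair (r := (· ≤ ·)) hxy).exists_maxChain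
  exact ⟨C, hC, hy (by simp), hy (by simp)⟩

theorem pos_mem_chainCurve {C : Set P} {c : P} (hc : c ∈ C) : d.pos c ∈ d.chainCurve C :=
  Or.inl ⟨c, hc, rfl⟩

theorem onLeft_of_mem {C : Set P} {c : P} (hc : c ∈ C) : d.OnLeft c C :=
  ⟨_, d.pos_mem_chainCurve hc, rfl, le_rfl⟩

theorem onRight_of_mem {C : Set P} {c : P} (hc : c ∈ C) : d.OnRight c C :=
  ⟨_, d.pos_mem_chainCurve hc, rfl, le_rfl⟩

theorem mem_chainCurve_cases {C : Set P} {z : ℝ × ℝ} (hz : z ∈ d.chainCurve C) :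
    (∃ c ∈ C, d.pos c = z) ∨
      ∃ a ∈ C, ∃ b ∈ C, a ⋖ b ∧ z ∈ openSegment ℝ (d.pos a) (d.pos b) := by
  rcases hz with hz | ⟨a, ha, b, hb, hab, hz⟩
  · exact Or.inl hz
  rw [← insert_endpoints_openSegment] at hz
  rcases hz with rfl | rfl | hz
  · exact Or.inl ⟨a, ha, rfl⟩
  · exact Or.inl ⟨b, hb, rfl⟩
  · exact Or.inr ⟨a, ha, b, hb, hab, hz⟩

theorem mem_of_pos_mem_chainCurve {C : Set P} {c : P} (hc : d.pos c ∈ d.chainCurve C) :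
    c ∈ C := by
  rcases d.mem_chainCurve_cases hc with ⟨a, ha, hac⟩ | ⟨a, ha, b, hb, hab, hz⟩
  · rwa [← d.pos_injective hac]
  · exact absurd hz (d.vertex_notMem_edge a b c hab)

theorem _root_.exists_mem_openSegment_snd {p q : ℝ × ℝ} {t : ℝ} (h₁ : p.2 < t) (h₂ : t < q.2) :
    ∃ z ∈ openSegment ℝ p q, z.2 = t := by
  have h : 0 < q.2 - p.2 := by linarith
  refine ⟨((q.2 - t) / (q.2 - p.2)) • p + ((t - p.2) / (q.2 - p.2)) • q,
    ⟨_, _, div_pos (by linarith) h, div_pos (by linarith) h, by field_simp; ring, rfl⟩, ?_⟩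
  simp only [Prod.snd_add, Prod.smul_snd, smul_eq_mul]
  field_simp
  ring

theorem _root_.snd_lt_of_mem_openSegment {p q z : ℝ × ℝ} (hpq : p.2 < q.2)
    (hz : z ∈ openSegment ℝ p q) : p.2 < z.2 ∧ z.2 < q.2 := by
  obtain ⟨s, t, hs, ht, hst, rfl⟩ := hz
  simp only [Prod.snd_add, Prod.smul_snd, smul_eq_mul]
  obtain rfl : s = 1 - t := by linarith
  constructor <;> nlinarith

theorem _root_.eq_of_mem_segment_of_snd_eq {p q z w : ℝ × ℝ} (hpq : p.2 < q.2)
    (hz : z ∈ segment ℝ p q) (hw : w ∈ segment ℝ p q) (h : z.2 = w.2) : z = w := by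
  obtain ⟨s, t, hs, ht, hst, rfl⟩ := hz
  obtain ⟨s', t', hs', ht', hst', rfl⟩ := hw
  simp only [Prod.snd_add, Prod.smul_snd, smul_eq_mul] at h
  obtain rfl : s = 1 - t := by linarith
  obtain rfl : s' = 1 - t' := by linarith
  have : (t - t') * (q.2 - p.2) = 0 := by linarith
  rcases mul_eq_zero.1 this with h | h
  · obtain rfl : t = t' := by linarith
    rfl
  · linarith

/-- The last vertex of C of height at most t and the next vertex of C form a covering pair by
maximality of C, and their edge passes height t. -/
theorem exists_mem_chainCurve_snd [BoundedOrder P] [Finite P] {C : Set P}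
    (hC : IsMaxChain (· ≤ ·) C) {t : ℝ} (h₁ : (d.pos ⊥).2 ≤ t) (h₂ : t ≤ (d.pos ⊤).2) :
    ∃ z ∈ d.chainCurve C, z.2 = t := by
  obtain ⟨a, ⟨haC, hat⟩, hamax⟩ := (Set.toFinite {c | c ∈ C ∧ (d.pos c).2 ≤ t}).exists_maximal
    ⟨⊥, hC.bot_mem, h₁⟩
  rcases hat.eq_or_lt with rfl | hat
  · exact ⟨_, d.pos_mem_chainCurve haC, rfl⟩
  have hatop : a < ⊤ := lt_top_iff_ne_top.2 fun h => by subst h; linarith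
  obtain ⟨b, ⟨hbC, hab⟩, hbmin⟩ := (Set.toFinite {c | c ∈ C ∧ a < c}).exists_minimal
    ⟨⊤, hC.top_mem, hatop⟩
  have hcov : a ⋖ b := by
    refine ⟨hab, fun c hac hcb => ?_⟩
    have hcC : c ∈ C := by
      by_contra hcC
      refine hcC ?_
      have hins : IsChain (· ≤ ·) (insert c C) := by
        refine hC.1.insert fun e he _ => ?_
        rcases hC.1.total he haC with hea | hae
        · exact Or.inr (hea.trans hac.le)
        rcases hae.eq_or_lt with rfl | hae
        · exact Or.inr hac.le
        rcases hC.1.total he hbC with heb | hbe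
        · exact Or.inl (hcb.le.trans (hbmin ⟨he, hae⟩ heb))
        · exact Or.inl (hcb.le.trans hbe)
      rw [hC.2 hins (Set.subset_insert c C)]
      exact Set.mem_insert c C
    exact absurd (hbmin ⟨hcC, hac⟩ hcb.le) (not_le_of_gt hcb)
  have htb : t < (d.pos b).2 := by
    by_contra hbt
    exact absurd (hamax ⟨hbC, not_lt.1 hbt⟩ hab.le) (not_le_of_gt hab)
  obtain ⟨z, hz, rfl⟩ := exists_mem_openSegment_snd hat htb
  exact ⟨z, Or.inr ⟨a, haC, b, hbC, hcov, openSegment_subset_segment _ _ _ hz⟩, rfl⟩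

theorem exists_mem_chainCurve_height [BoundedOrder P] [Finite P] {C : Set P}
    (hC : IsMaxChain (· ≤ ·) C) (x : P) : ∃ z ∈ d.chainCurve C, z.2 = (d.pos x).2 :=
  d.exists_mem_chainCurve_snd hC (d.height_strictMono.monotone bot_le)
    (d.height_strictMono.monotone le_top)

theorem lt_of_height_lt [Finite P] {C : Set P} (hC : IsMaxChain (· ≤ ·) C) {a b : P} (ha : a ∈ C)
    (hb : b ∈ C) (h : (d.pos a).2 < (d.pos b).2) : a < b := by
  rcases hC.1.total ha hb with h' | h'
  · exact lt_of_le_of_ne h' (by rintro rfl; exact lt_irrefl _ h)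
  · exact absurd (d.height_strictMono.monotone h') (not_le.2 h)

/-- The curve is a graph over the height axis: between the heights of a covering pair in C there is
no other vertex of C, so each height belongs to one vertex or one edge. -/
theorem chainCurve_eq_of_snd_eq [Finite P] {C : Set P} (hC : IsMaxChain (· ≤ ·) C) {z w : ℝ × ℝ}
    (hz : z ∈ d.chainCurve C) (hw : w ∈ d.chainCurve C) (h : z.2 = w.2) : z = w := by
  rcases d.mem_chainCurve_cases hz with ⟨c, hc, rfl⟩ | ⟨a, ha, b, hb, hab, hz⟩ <;>
    rcases d.mem_chainCurve_cases hw with ⟨c', hc', rfl⟩ | ⟨a', ha', b', hb', hab', hw⟩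
  · rcases hC.1.total hc hc' with hcc | hcc
    · rcases hcc.eq_or_lt with rfl | hcc
      · rfl
      · exact absurd h (d.height_strictMono hcc).ne
    · rcases hcc.eq_or_lt with rfl | hcc
      · rfl
      · exact absurd h (d.height_strictMono hcc).ne'
  · have hh := snd_lt_of_mem_openSegment (d.height_lt _ _ hab') hw
    exfalso
    have h₁ : a' < c := d.lt_of_height_lt hC ha' hc (by linarith)
    have h₂ : c < b' := d.lt_of_height_lt hC hc hb' (by linarith)
    exact hab'.2 h₁ h₂
  · have hh := snd_lt_of_mem_openSegment (d.height_lt _ _ hab) hz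
    exfalso
    have h₁ : a < c' := d.lt_of_height_lt hC ha hc' (by linarith)
    have h₂ : c' < b := d.lt_of_height_lt hC hc' hb (by linarith)
    exact hab.2 h₁ h₂
  · have hh := snd_lt_of_mem_openSegment (d.height_lt _ _ hab) hz
    have hh' := snd_lt_of_mem_openSegment (d.height_lt _ _ hab') hw
    have h₁ : a < b' := d.lt_of_height_lt hC ha hb' (by linarith)
    have h₂ : a' < b := d.lt_of_height_lt hC ha' hb (by linarith)
    obtain rfl : a = a' := by
      rcases hC.1.total ha ha' with h' | h' <;> rcases h'.eq_or_lt with h' | h'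
      · exact h'
      · exact absurd h₂ (hab.2 h')
      · exact h'.symm
      · exact absurd h₁ (hab'.2 h')
    obtain rfl : b = b' := by
      rcases hC.1.total hb hb' with h' | h' <;> rcases h'.eq_or_lt with h' | h'
      · exact h'
      · exact absurd h' (hab'.2 hab.lt)
      · exact h'.symm
      · exact absurd h' (hab.2 hab'.lt)
    exact eq_of_mem_segment_of_snd_eq (d.height_lt _ _ hab) (openSegment_subset_segment _ _ _ hz)
      (openSegment_subset_segment _ _ _ hw) h

theorem isCompact_chainCurve [Finite P] (C : Set P) : IsCompact (d.chainCurve C) := by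
  have hseg : ∀ p q : ℝ × ℝ, IsCompact (segment ℝ p q) := fun p q => by
    rw [← convexHull_pair (𝕜 := ℝ)]
    exact (Set.toFinite {p, q}).isCompact_convexHull ℝ
  have h : d.chainCurve C = d.pos '' C ∪
      ⋃ e ∈ {e : P × P | e.1 ∈ C ∧ e.2 ∈ C ∧ e.1 ⋖ e.2}, segment ℝ (d.pos e.1) (d.pos e.2) := by
    ext z
    simp only [chainCurve, Set.mem_union, Set.mem_ofPred_eq, Set.mem_iUnion, Prod.exists,
      exists_prop]
    refine or_congr Iff.rfl ⟨?_, ?_⟩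
    · rintro ⟨a, ha, b, hb, hab, hz⟩
      exact ⟨a, b, ⟨ha, hb, hab⟩, hz⟩
    · rintro ⟨a, b, ⟨ha, hb, hab⟩, hz⟩
      exact ⟨a, ha, b, hb, hab, hz⟩
  rw [h]
  exact (Set.toFinite _).isCompact.union ((Set.toFinite _).isCompact_biUnion fun e _ => hseg _ _)

/-- Two compact graphs of functions over an interval that change sides have a common point. -/
theorem _root_.exists_common_point_of_isCompact {K L : Set (ℝ × ℝ)} (hK : IsCompact K)
    (hL : IsCompact L) {s t : ℝ}
    (hKs : ∀ r ∈ Set.uIcc s t, ∃ z ∈ K, z.2 = r) (hLs : ∀ r ∈ Set.uIcc s t, ∃ z ∈ L, z.2 = r)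
    (hKu : ∀ z ∈ K, ∀ w ∈ K, z.2 = w.2 → z = w) (hLu : ∀ z ∈ L, ∀ w ∈ L, z.2 = w.2 → z = w)
    {k l k' l' : ℝ × ℝ} (hk : k ∈ K) (hl : l ∈ L) (hk' : k' ∈ K) (hl' : l' ∈ L)
    (hks : k.2 = s) (hls : l.2 = s) (hkt : k'.2 = t) (hlt : l'.2 = t)
    (hkl : k.1 ≤ l.1) (hlk : l'.1 ≤ k'.1) :
    ∃ z, z ∈ K ∧ z ∈ L ∧ z.2 ∈ Set.uIcc s t := by
  have closed : ∀ {K L : Set (ℝ × ℝ)}, IsCompact K → IsCompact L →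
      IsClosed {r : ℝ | ∃ z ∈ K, ∃ w ∈ L, z.2 = r ∧ w.2 = r ∧ z.1 ≤ w.1} := by
    intro K L hK hL
    have : {r : ℝ | ∃ z ∈ K, ∃ w ∈ L, z.2 = r ∧ w.2 = r ∧ z.1 ≤ w.1} =
        (fun v : (ℝ × ℝ) × (ℝ × ℝ) => v.1.2) ''
          ((K ×ˢ L) ∩ {v | v.1.2 = v.2.2 ∧ v.1.1 ≤ v.2.1}) := by
      ext r
      constructor
      · rintro ⟨z, hz, w, hw, rfl, h, h'⟩
        exact ⟨(z, w), ⟨⟨hz, hw⟩, h.symm, h'⟩, rfl⟩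
      · rintro ⟨v, ⟨⟨hz, hw⟩, h, h'⟩, rfl⟩
        exact ⟨v.1, hz, v.2, hw, rfl, h.symm, h'⟩
    rw [this]
    refine (((hK.prod hL).inter_right ?_).image (by fun_prop)).isClosed
    exact (isClosed_eq (f := fun v : (ℝ × ℝ) × (ℝ × ℝ) => v.1.2) (g := fun v => v.2.2)
      (by fun_prop) (by fun_prop)).inter
      (isClosed_le (f := fun v : (ℝ × ℝ) × (ℝ × ℝ) => v.1.1) (g := fun v => v.2.1)
        (by fun_prop) (by fun_prop))
  -- The heights where K is weakly left of L and those where L is weakly left of K are closed and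
  -- cover a connected interval, so they share a height, where the curves meet.
  have := isPreconnected_closed_iff.1 (isPreconnected_uIcc (a := s) (b := t)) _ _
    (closed hK hL) (closed hL hK) ?_ ⟨s, Set.left_mem_uIcc, k, hk, l, hl, hks, hls, hkl⟩
    ⟨t, Set.right_mem_uIcc, l', hl', k', hk', hlt, hkt, hlk⟩
  · obtain ⟨r, hr, ⟨z, hz, w, hw, hzr, hwr, hzw⟩, w', hw', z', hz', hwr', hzr', hwz⟩ := this
    obtain rfl := hKu z hz z' hz' (hzr.trans hzr'.symm)
    obtain rfl := hLu w hw w' hw' (hwr.trans hwr'.symm)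
    obtain rfl : z = w := Prod.ext (le_antisymm hzw hwz) (hzr.trans hwr.symm)
    exact ⟨z, hz, hw, hzr ▸ hr⟩
  · intro r hr
    obtain ⟨z, hz, hzr⟩ := hKs r hr
    obtain ⟨w, hw, hwr⟩ := hLs r hr
    rcases le_total z.1 w.1 with h | h
    · exact Or.inl ⟨z, hz, w, hw, hzr, hwr, h⟩
    · exact Or.inr ⟨w, hw, z, hz, hwr, hzr, h⟩

end HasseDiagram

/-! ### Planar diagrams are quasiplanar -/

namespace HasseDiagram

variable {P : Type*} [PartialOrder P] (d : HasseDiagram P)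

theorem onLeft_or_onRight [BoundedOrder P] [Finite P] {C : Set P} (hC : IsMaxChain (· ≤ ·) C)
    (x : P) : d.OnLeft x C ∨ d.OnRight x C := by
  obtain ⟨z, hz, hzx⟩ := d.exists_mem_chainCurve_height hC x
  rcases le_total (d.pos x).1 z.1 with h | h
  · exact Or.inl ⟨z, hz, hzx, h⟩
  · exact Or.inr ⟨z, hz, hzx, h⟩

theorem mem_of_onLeft_of_onRight [Finite P] {C : Set P} (hC : IsMaxChain (· ≤ ·) C) {x : P}
    (hl : d.OnLeft x C) (hr : d.OnRight x C) : x ∈ C := by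
  obtain ⟨z, hz, hzx, h⟩ := hl
  obtain ⟨w, hw, hwx, h'⟩ := hr
  obtain rfl := d.chainCurve_eq_of_snd_eq hC hz hw (hzx.trans hwx.symm)
  have : z = d.pos x := Prod.ext (le_antisymm h' h) hzx
  exact d.mem_of_pos_mem_chainCurve (this ▸ hz)

/-- In a planar diagram, maximal chains through two incomparable elements do not meet between the
heights of these elements. -/
theorem IsPlanar.snd_notMem_uIcc [Finite P] {d : HasseDiagram P} (hd : d.IsPlanar) {x y : P}
    (hxy : ¬ x ≤ y) (hyx : ¬ y ≤ x) {C E : Set P} (hC : IsMaxChain (· ≤ ·) C)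
    (hE : IsMaxChain (· ≤ ·) E) (hy : y ∈ C) (hx : x ∈ E) {z : ℝ × ℝ} (hzC : z ∈ d.chainCurve C)
    (hzE : z ∈ d.chainCurve E) : z.2 ∉ Set.uIcc (d.pos x).2 (d.pos y).2 := by
  wlog h : (d.pos x).2 ≤ (d.pos y).2 generalizing x y C E
  · rw [Set.uIcc_comm]
    exact this hyx hxy hE hC hx hy hzE hzC (not_le.1 h).le
  rw [Set.uIcc_of_le h]
  rintro ⟨h₁, h₂⟩
  have le_of : ∀ {F : Set P}, IsMaxChain (· ≤ ·) F → ∀ {a b : P}, a ∈ F → b ∈ F →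
      (d.pos a).2 ≤ (d.pos b).2 → a ≤ b := by
    intro F hF a b ha hb hab
    rcases hF.1.total ha hb with h' | h'
    · exact h'
    · rcases h'.eq_or_lt with rfl | h'
      · exact le_rfl
      · exact absurd hab (not_le.2 (d.height_strictMono h'))
  -- A common vertex c would give x ≤ c ≤ y. A common interior point of edges forces a common edge a
  -- ⋖ b with a ≤ y and x ≤ b, and the covering then makes x and y comparable.
  rcases d.mem_chainCurve_cases hzC with ⟨c, hc, rfl⟩ | ⟨a, ha, b, hb, hab, hz⟩
  · exact hxy ((le_of hE hx (d.mem_of_pos_mem_chainCurve hzE) h₁).trans (le_of hC hc hy h₂))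
  · rcases d.mem_chainCurve_cases hzE with ⟨c', hc', rfl⟩ | ⟨a', ha', b', hb', hab', hz'⟩
    · exact d.vertex_notMem_edge _ _ _ hab hz
    · have heq : (a, b) = (a', b') := by
        by_contra hne
        exact Set.disjoint_left.1 (hd a b a' b' hab hab' hne) hz hz'
      obtain ⟨rfl, rfl⟩ := Prod.mk.inj heq
      have hh := snd_lt_of_mem_openSegment (d.height_lt _ _ hab) hz
      have hay : a ≤ y := le_of hC ha hy (by linarith)
      have hxb : x ≤ b := le_of hE hx hb' (by linarith)
      rcases hE.1.total hx ha' with hxa | hax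
      · exact hxy (hxa.trans hay)
      rcases hax.eq_or_lt with rfl | hax
      · exact hxy hay
      rcases hxb.eq_or_lt with rfl | hxb
      · exact (hC.1.total hb hy).elim hxy hyx
      · exact hab.2 hax hxb

/-- Otherwise the curves of C and E would change sides between the heights of x and y, hence meet
there, against `snd_notMem_uIcc`. Since C and E vary independently, the side does not depend on the
chain chosen. -/
theorem IsPlanar.onLeft_iff_onRight [BoundedOrder P] [Finite P] {d : HasseDiagram P}
    (hd : d.IsPlanar) {x y : P} (hxy : ¬ x ≤ y) (hyx : ¬ y ≤ x) {C E : Set P}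
    (hC : IsMaxChain (· ≤ ·) C) (hE : IsMaxChain (· ≤ ·) E) (hy : y ∈ C) (hx : x ∈ E) :
    d.OnLeft x C ↔ d.OnRight y E := by
  have mono := d.height_strictMono.monotone
  have cover : ∀ {F : Set P}, IsMaxChain (· ≤ ·) F →
      ∀ r ∈ Set.uIcc (d.pos x).2 (d.pos y).2, ∃ z ∈ d.chainCurve F, z.2 = r := by
    intro F hF r hr
    obtain ⟨h₁, h₂⟩ := Set.mem_Icc.1 hr
    exact d.exists_mem_chainCurve_snd hF ((le_inf (mono bot_le) (mono bot_le)).trans h₁)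
      (h₂.trans (sup_le (mono le_top) (mono le_top)))
  have uniq : ∀ {F : Set P}, IsMaxChain (· ≤ ·) F → ∀ z ∈ d.chainCurve F,
      ∀ w ∈ d.chainCurve F, z.2 = w.2 → z = w :=
    fun hF z hz w hw => d.chainCurve_eq_of_snd_eq hF hz hw
  constructor
  · rintro ⟨z, hz, hzx, h⟩
    refine (d.onLeft_or_onRight hE y).resolve_left ?_
    rintro ⟨w, hw, hwy, h'⟩
    obtain ⟨p, hpE, hpC, hp⟩ := exists_common_point_of_isCompact (d.isCompact_chainCurve E)
      (d.isCompact_chainCurve C) (cover hE) (cover hC) (uniq hE) (uniq hC)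
      (d.pos_mem_chainCurve hx) hz hw (d.pos_mem_chainCurve hy) rfl hzx hwy rfl h h'
    exact hd.snd_notMem_uIcc hxy hyx hC hE hy hx hpC hpE hp
  · rintro ⟨z, hz, hzy, h⟩
    refine (d.onLeft_or_onRight hC x).resolve_right ?_
    rintro ⟨w, hw, hwx, h'⟩
    obtain ⟨p, hpC, hpE, hp⟩ := exists_common_point_of_isCompact (d.isCompact_chainCurve C)
      (d.isCompact_chainCurve E) (cover hC) (cover hE) (uniq hC) (uniq hE)
      hw (d.pos_mem_chainCurve hx) (d.pos_mem_chainCurve hy) hz hwx rfl rfl hzy h' h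
    exact hd.snd_notMem_uIcc hxy hyx hC hE hy hx hpC hpE hp

theorem IsPlanar.isQuasiplanar [BoundedOrder P] [Finite P] {d : HasseDiagram P}
    (hd : d.IsPlanar) : d.IsQuasiplanar where
  left_of_every := by
    rintro x y ⟨hxy, hyx, C, hC, hy, h⟩ C' hC' hy'
    obtain ⟨E, hE, hx⟩ := exists_isMaxChain_mem x
    rw [hd.onLeft_iff_onRight hxy hyx hC' hE hy' hx]
    exact (hd.onLeft_iff_onRight hxy hyx hC hE hy hx).1 h
  lft_iff_rght := by
    intro x y
    constructor
    · rintro ⟨hxy, hyx, C, hC, hy, h⟩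
      obtain ⟨E, hE, hx⟩ := exists_isMaxChain_mem x
      exact ⟨hyx, hxy, E, hE, hx, (hd.onLeft_iff_onRight hxy hyx hC hE hy hx).1 h⟩
    · rintro ⟨hyx, hxy, E, hE, hx, h⟩
      obtain ⟨C, hC, hy⟩ := exists_isMaxChain_mem y
      exact ⟨hxy, hyx, C, hC, hy, (hd.onLeft_iff_onRight hxy hyx hC hE hy hx).2 h⟩

theorem _root_.mem_segment_of_slope {p q : ℝ × ℝ} {t : ℝ} (h : 0 < q.2 - p.2) (hp : p.2 ≤ t)
    (hq : t ≤ q.2) : (q.1 + (p.1 - q.1) / (q.2 - p.2) * (q.2 - t), t) ∈ segment ℝ p q := by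
  refine ⟨(q.2 - t) / (q.2 - p.2), (t - p.2) / (q.2 - p.2), div_nonneg (by linarith) h.le,
    div_nonneg (by linarith) h.le, by field_simp; ring, Prod.ext ?_ ?_⟩ <;>
  · simp only [Prod.fst_add, Prod.smul_fst, Prod.snd_add, Prod.smul_snd, smul_eq_mul]
    field_simp
    ring

/-! ### Transitivity of λ in quasiplanar diagrams -/

namespace IsQuasiplanar

variable [BoundedOrder P] {d}

theorem lt_or_lft_of_lft_of_le (hd : d.IsQuasiplanar) {x y z : P} (hxy : d.Lft x y)
    (hyz : y ≤ z) : x < z ∨ d.Lft x z := by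
  obtain ⟨C, hC, hy, hz⟩ := exists_isMaxChain_mem_mem hyz
  have hzx : ¬ z ≤ x := fun h => hxy.2.1 (hyz.trans h)
  by_cases h : x ≤ z
  · exact Or.inl (lt_of_le_not_ge h hzx)
  · exact Or.inr ⟨h, hzx, C, hC, hz, hd.left_of_every x y hxy C hC hy⟩

variable [Finite P]

theorem lft_asymm (hd : d.IsQuasiplanar) {x y : P} (hxy : d.Lft x y) : ¬ d.Lft y x := by
  intro hyx
  obtain ⟨h₁, h₂, C, hC, hy, hr⟩ := (hd.lft_iff_rght _ _).1 hyx
  exact (hC.1.total (d.mem_of_onLeft_of_onRight hC (hd.left_of_every _ _ hxy C hC hy) hr) hy).elim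
    h₁ h₂

theorem lft_total (hd : d.IsQuasiplanar) {x y : P} (hxy : ¬ x ≤ y) (hyx : ¬ y ≤ x) :
    d.Lft x y ∨ d.Lft y x := by
  obtain ⟨C, hC, hy⟩ := exists_isMaxChain_mem y
  rcases d.onLeft_or_onRight hC x with h | h
  · exact Or.inl ⟨hxy, hyx, C, hC, hy, h⟩
  · exact Or.inr ((hd.lft_iff_rght _ _).2 ⟨hxy, hyx, C, hC, hy, h⟩)

theorem lt_or_lft_of_le_of_lft (hd : d.IsQuasiplanar) {x y z : P} (hxy : d.Lft x y)
    (hxz : x ≤ z) : y < z ∨ d.Lft z y := by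
  have hzy : ¬ z ≤ y := fun h => hxy.1 (hxz.trans h)
  by_cases h : y ≤ z
  · exact Or.inl (lt_of_le_not_ge h hzy)
  refine Or.inr ((hd.lft_total h hzy).resolve_left fun hyz => ?_)
  obtain ⟨C, hC, hx, hz⟩ := exists_isMaxChain_mem_mem hxz
  exact hd.lft_asymm hxy ⟨hxy.2.1, hxy.1, C, hC, hx, hd.left_of_every y z hyz C hC hz⟩

/-- Edges with a common upper end have the horizontal order of their lower ends. -/
theorem slope_lt_of_lft_of_covBy (hd : d.IsQuasiplanar) {x y u : P} (hxy : d.Lft x y)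
    (hx : x ⋖ u) (hy : y ⋖ u) :
    ((d.pos x).1 - (d.pos u).1) / ((d.pos u).2 - (d.pos x).2) <
      ((d.pos y).1 - (d.pos u).1) / ((d.pos u).2 - (d.pos y).2) := by
  have hxu : 0 < (d.pos u).2 - (d.pos x).2 := sub_pos.2 (d.height_lt _ _ hx)
  have hyu : 0 < (d.pos u).2 - (d.pos y).2 := sub_pos.2 (d.height_lt _ _ hy)
  -- The quotients are horizontal displacements from u per unit of descent. They are compared at the
  -- height of the higher of x and y, where the edge from the other one to u is part of a maximal
  -- chain.
  rcases le_total (d.pos y).2 (d.pos x).2 with h | h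
  · obtain ⟨C, hC, hyC, huC⟩ := exists_isMaxChain_mem_mem hy.le
    obtain ⟨w, hw, hwx, hle⟩ := hd.left_of_every x y hxy C hC hyC
    have hz : _ ∈ d.chainCurve C := Or.inr ⟨y, hyC, u, huC, hy,
      mem_segment_of_slope hyu h (sub_nonneg.1 hxu.le)⟩
    obtain rfl := d.chainCurve_eq_of_snd_eq hC hw hz hwx
    have hlt := lt_of_le_of_ne hle fun heq =>
      (hC.1.total (d.mem_of_pos_mem_chainCurve
        ((Prod.ext heq.symm hwx : _ = d.pos x) ▸ hw)) hyC).elim hxy.1 hxy.2.1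
    rw [div_lt_iff₀ hxu]
    linarith
  · obtain ⟨C, hC, hxC, huC⟩ := exists_isMaxChain_mem_mem hx.le
    obtain ⟨-, -, C', hC', hxC', hr⟩ := (hd.lft_iff_rght _ _).1 hxy
    rcases d.onLeft_or_onRight hC y with hl | ⟨w, hw, hwy, hle⟩
    · exact absurd ⟨hxy.2.1, hxy.1, C, hC, hxC, hl⟩ (hd.lft_asymm hxy)
    have hz : _ ∈ d.chainCurve C := Or.inr ⟨x, hxC, u, huC, hx,
      mem_segment_of_slope hxu h (sub_nonneg.1 hyu.le)⟩
    obtain rfl := d.chainCurve_eq_of_snd_eq hC hw hz hwy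
    have hlt := lt_of_le_of_ne hle fun heq =>
      (hC.1.total hxC (d.mem_of_pos_mem_chainCurve
        ((Prod.ext heq hwy : _ = d.pos y) ▸ hw))).elim hxy.1 hxy.2.1
    rw [lt_div_iff₀ hyu]
    linarith

/-- An element above one member of a 3-cycle of λ either can replace that member in the cycle or is
above the other two as well. -/
theorem lft_or_lt_of_cycle (hd : d.IsQuasiplanar) {x y z u : P} (hxy : d.Lft x y)
    (hyz : d.Lft y z) (hzx : d.Lft z x) (hyu : y ≤ u) :
    (d.Lft x u ∧ d.Lft u z) ∨ (x < u ∧ z < u) := by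
  rcases hd.lt_or_lft_of_lft_of_le hxy hyu with h₁ | h₁ <;>
    rcases hd.lt_or_lft_of_le_of_lft hyz hyu with h₂ | h₂
  · exact Or.inr ⟨h₁, h₂⟩
  · exact ((hd.lt_or_lft_of_lft_of_le hzx h₁.le).elim (fun h => h₂.2.1 h.le)
      fun h => hd.lft_asymm h h₂).elim
  · exact ((hd.lt_or_lft_of_le_of_lft hzx h₂.le).elim (fun h => h₁.1 h.le)
      fun h => hd.lft_asymm h h₁).elim
  · exact Or.inl ⟨h₁, h₂⟩

/-- In a componentwise maximal 3-cycle no member can be replaced by a larger element, so all three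
have the same strict upper bounds and hence a common upper cover. The slopes of the three edges into
it would then increase cyclically. -/
theorem not_cycle (hd : d.IsQuasiplanar) {x y z : P} (hxy : d.Lft x y) (hyz : d.Lft y z) :
    ¬ d.Lft z x := by
  intro hzx
  obtain ⟨⟨x, y, z⟩, ⟨hxy, hyz, hzx⟩, hmax⟩ := (Set.toFinite
    {t : P × P × P | d.Lft t.1 t.2.1 ∧ d.Lft t.2.1 t.2.2 ∧ d.Lft t.2.2 t.1}).exists_maximal
    ⟨(x, y, z), hxy, hyz, hzx⟩
  have hx : ∀ u, x < u → z < u ∧ y < u := by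
    intro u hu
    refine (hd.lft_or_lt_of_cycle hzx hxy hyz hu.le).resolve_left fun h => ?_
    exact hu.not_ge (hmax (y := (u, y, z)) ⟨h.2, hyz, h.1⟩ ⟨hu.le, le_rfl, le_rfl⟩).1
  have hy : ∀ u, y < u → x < u ∧ z < u := by
    intro u hu
    refine (hd.lft_or_lt_of_cycle hxy hyz hzx hu.le).resolve_left fun h => ?_
    exact hu.not_ge (hmax (y := (x, u, z)) ⟨h.1, h.2, hzx⟩ ⟨le_rfl, hu.le, le_rfl⟩).2.1
  have hz : ∀ u, z < u → y < u ∧ x < u := by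
    intro u hu
    refine (hd.lft_or_lt_of_cycle hyz hzx hxy hu.le).resolve_left fun h => ?_
    exact hu.not_ge (hmax (y := (x, y, u)) ⟨hxy, h.1, h.2⟩ ⟨le_rfl, le_rfl, hu.le⟩).2.2
  have hxtop : x < ⊤ := lt_top_iff_ne_top.2 fun h => hxy.2.1 (h ▸ le_top)
  obtain ⟨u, hxu, -⟩ := exists_covBy_le_of_lt hxtop
  have hyu : y ⋖ u := ⟨(hx u hxu.lt).2, fun w hw => hxu.2 (hy w hw).1⟩
  have hzu : z ⋖ u := ⟨(hx u hxu.lt).1, fun w hw => hxu.2 (hz w hw).2⟩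
  exact lt_irrefl _ (((hd.slope_lt_of_lft_of_covBy hxy hxu hyu).trans
    (hd.slope_lt_of_lft_of_covBy hyz hyu hzu)).trans (hd.slope_lt_of_lft_of_covBy hzx hzu hxu))

theorem isConjugate (hd : d.IsQuasiplanar) : IsConjugate d.Lft where
  incomp h := ⟨h.1, h.2.1⟩
  total h₁ h₂ := hd.lft_total h₁ h₂
  trans {x y z} hxy hyz := by
    refine (hd.lft_total (fun hxz => ?_) fun hzx => ?_).resolve_right (hd.not_cycle hxy hyz)
    · exact (hd.lt_or_lft_of_le_of_lft hxy hxz).elim (fun h => hyz.1 h.le) (hd.lft_asymm hyz)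
    · exact (hd.lt_or_lft_of_lft_of_le hyz hzx).elim (fun h => hxy.2.1 h.le) (hd.lft_asymm hxy)

end IsQuasiplanar

end HasseDiagram

/-! ### Drawing a conjugate relation by ranks -/

namespace IsConjugate

open HasseDiagram

variable {P : Type*} [PartialOrder P] [Finite P] {r : P → P → Prop}

/-- The point whose coordinates along two perpendicular axes are the two ranks. -/
noncomputable def point (r : P → P → Prop) (x : P) : ℝ × ℝ :=
  ((rank r x : ℝ) - rank (Function.swap r) x, (rank r x : ℝ) + rank (Function.swap r) x)

/-- The sum and the difference of the coordinates are twice the two ranks. -/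
theorem le_iff_point (h : IsConjugate r) {x y : P} :
    x ≤ y ↔ (point r x).2 + (point r x).1 ≤ (point r y).2 + (point r y).1 ∧
      (point r x).2 - (point r x).1 ≤ (point r y).2 - (point r y).1 := by
  rw [h.le_iff, ← h.rank_le_rank, ← h.swap.rank_le_rank, ← Nat.cast_le (α := ℝ),
    ← Nat.cast_le (α := ℝ)]
  simp only [point]
  constructor <;> rintro ⟨h₁, h₂⟩ <;> constructor <;> linarith

theorem point_injective (h : IsConjugate r) : Function.Injective (point r) := fun x y hxy =>
  _root_.le_antisymm (h.le_iff_point.2 (by rw [hxy]; exact ⟨le_rfl, le_rfl⟩))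
    (h.le_iff_point.2 (by rw [hxy]; exact ⟨le_rfl, le_rfl⟩))

theorem add_sub_lt_of_mem_openSegment (h : IsConjugate r) {a b : P} (hab : a < b) {z : ℝ × ℝ}
    (hz : z ∈ openSegment ℝ (point r a) (point r b)) :
    ((point r a).2 + (point r a).1 < z.2 + z.1 ∧ z.2 + z.1 < (point r b).2 + (point r b).1) ∧
      ((point r a).2 - (point r a).1 < z.2 - z.1 ∧
        z.2 - z.1 < (point r b).2 - (point r b).1) := by
  have h₁ := h.rank_lt_rank (Or.inl hab.le) hab.ne
  have h₂ := h.swap.rank_lt_rank (Or.inl hab.le) hab.ne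
  rw [← Nat.cast_lt (α := ℝ)] at h₁ h₂
  obtain ⟨s, t, hs, ht, hst, rfl⟩ := hz
  obtain rfl : s = 1 - t := by linarith
  simp only [point, Prod.fst_add, Prod.smul_fst, Prod.snd_add, Prod.smul_snd, smul_eq_mul]
  have h₃ := mul_pos ht (sub_pos.2 h₁)
  have h₄ := mul_pos ht (sub_pos.2 h₂)
  have h₅ := mul_pos hs (sub_pos.2 h₁)
  have h₆ := mul_pos hs (sub_pos.2 h₂)
  refine ⟨⟨?_, ?_⟩, ?_, ?_⟩ <;> linarith

/-- The diagram whose coordinates are the ranks in the two linear orders, turned by 45 degrees. -/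
noncomputable def diagram (h : IsConjugate r) : HasseDiagram P where
  pos := point r
  pos_injective := h.point_injective
  height_lt a b hab := by
    have h₁ := h.rank_lt_rank (Or.inl hab.le) hab.lt.ne
    have h₂ := h.swap.rank_lt_rank (Or.inl hab.le) hab.lt.ne
    rw [← Nat.cast_lt (α := ℝ)] at h₁ h₂
    exact add_lt_add h₁ h₂
  vertex_notMem_edge a b c hab hc := by
    obtain ⟨⟨h₁, h₂⟩, h₃, h₄⟩ := h.add_sub_lt_of_mem_openSegment hab.lt hc
    refine hab.2 (lt_of_le_not_ge (h.le_iff_point.2 ⟨h₁.le, h₃.le⟩) fun hca => ?_)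
      (lt_of_le_not_ge (h.le_iff_point.2 ⟨h₂.le, h₄.le⟩) fun hbc => ?_)
    · exact absurd (h.le_iff_point.1 hca).1 (not_le.2 h₁)
    · exact absurd (h.le_iff_point.1 hbc).1 (not_le.2 h₂)

/-- A maximal chain through `y` stays in the quadrants above and below `y`. -/
theorem mem_quadrant_of_mem_chainCurve (h : IsConjugate r) {C : Set P} (hC : IsMaxChain (· ≤ ·) C)
    {y : P} (hy : y ∈ C) {z : ℝ × ℝ} (hz : z ∈ h.diagram.chainCurve C) :
    ((point r y).2 + (point r y).1 ≤ z.2 + z.1 ∧ (point r y).2 - (point r y).1 ≤ z.2 - z.1) ∨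
    (z.2 + z.1 ≤ (point r y).2 + (point r y).1 ∧ z.2 - z.1 ≤ (point r y).2 - (point r y).1) := by
  rcases h.diagram.mem_chainCurve_cases hz with ⟨c, hc, rfl⟩ | ⟨a, ha, b, hb, hab, hz⟩
  · exact (hC.1.total hy hc).imp h.le_iff_point.1 h.le_iff_point.1
  · obtain ⟨⟨h₁, h₂⟩, h₃, h₄⟩ := h.add_sub_lt_of_mem_openSegment hab.lt hz
    by_cases hya : y ≤ a
    · have := h.le_iff_point.1 hya
      exact Or.inl ⟨this.1.trans h₁.le, this.2.trans h₃.le⟩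
    · have hby : b ≤ y := by
        have hay : a < y := lt_of_le_not_ge ((hC.1.total hy ha).resolve_left hya) hya
        rcases hC.1.total hb hy with h' | h'
        · exact h'
        · rcases h'.eq_or_lt with rfl | h'
          · exact _root_.le_rfl
          · exact absurd h' (hab.2 hay)
      have := h.le_iff_point.1 hby
      exact Or.inr ⟨h₂.le.trans this.1, h₄.le.trans this.2⟩

theorem rel_iff_point (h : IsConjugate r) {x y : P} (hxy : r x y) :
    (point r x).2 + (point r x).1 < (point r y).2 + (point r y).1 ∧
      (point r y).2 - (point r y).1 < (point r x).2 - (point r x).1 := by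
  obtain ⟨hne, h₁, h₂⟩ := h.rel_iff.1 hxy
  have h₁ := h.rank_lt_rank h₁ hne
  have h₂ := h.swap.rank_lt_rank h₂ hne.symm
  rw [← Nat.cast_lt (α := ℝ)] at h₁ h₂
  simp only [point]
  constructor <;> linarith

/-- The point of x lies strictly inside the left quadrant at y, while the chain stays in the upper
and lower quadrants, so at the height of x the chain is strictly to the right. -/
theorem diagram_onLeft (h : IsConjugate r) [BoundedOrder P] {x y : P} (hxy : r x y) {C : Set P}
    (hC : IsMaxChain (· ≤ ·) C) (hy : y ∈ C) : h.diagram.OnLeft x C ∧ ¬ h.diagram.OnRight x C := by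
  have key : ∀ z ∈ h.diagram.chainCurve C, z.2 = (point r x).2 → (point r x).1 < z.1 := by
    intro z hz hzx
    obtain ⟨h₁, h₂⟩ := h.rel_iff_point hxy
    rcases h.mem_quadrant_of_mem_chainCurve hC hy hz with ⟨h₃, h₄⟩ | ⟨h₃, h₄⟩ <;> linarith
  obtain ⟨z, hz, hzx⟩ := h.diagram.exists_mem_chainCurve_height hC x
  refine ⟨⟨z, hz, hzx, (key z hz hzx).le⟩, ?_⟩
  rintro ⟨w, hw, hwx, hle⟩
  exact absurd hle (not_le.2 (key w hw hwx))

theorem diagram_onRight (h : IsConjugate r) [BoundedOrder P] {x y : P} (hyx : r y x) {C : Set P}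
    (hC : IsMaxChain (· ≤ ·) C) (hy : y ∈ C) : h.diagram.OnRight x C ∧ ¬ h.diagram.OnLeft x C := by
  have key : ∀ z ∈ h.diagram.chainCurve C, z.2 = (point r x).2 → z.1 < (point r x).1 := by
    intro z hz hzx
    obtain ⟨h₁, h₂⟩ := h.rel_iff_point hyx
    rcases h.mem_quadrant_of_mem_chainCurve hC hy hz with ⟨h₃, h₄⟩ | ⟨h₃, h₄⟩ <;> linarith
  obtain ⟨z, hz, hzx⟩ := h.diagram.exists_mem_chainCurve_height hC x
  refine ⟨⟨z, hz, hzx, (key z hz hzx).le⟩, ?_⟩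
  rintro ⟨w, hw, hwx, hle⟩
  exact absurd hle (not_le.2 (key w hw hwx))

theorem diagram_lft [BoundedOrder P] (h : IsConjugate r) {x y : P} :
    h.diagram.Lft x y ↔ r x y := by
  constructor
  · rintro ⟨hxy, hyx, C, hC, hy, hl⟩
    exact (h.total hxy hyx).resolve_right fun h' => (h.diagram_onRight h' hC hy).2 hl
  · intro hxy
    obtain ⟨C, hC, hy⟩ := exists_isMaxChain_mem y
    exact ⟨(h.incomp hxy).1, (h.incomp hxy).2, C, hC, hy, (h.diagram_onLeft hxy hC hy).1⟩

theorem diagram_rght [BoundedOrder P] (h : IsConjugate r) {x y : P} :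
    h.diagram.Rght x y ↔ r y x := by
  constructor
  · rintro ⟨hxy, hyx, C, hC, hy, hl⟩
    exact (h.total hyx hxy).resolve_right fun h' => (h.diagram_onLeft h' hC hy).2 hl
  · intro hyx
    obtain ⟨C, hC, hy⟩ := exists_isMaxChain_mem y
    exact ⟨(h.incomp hyx).2, (h.incomp hyx).1, C, hC, hy, (h.diagram_onRight hyx hC hy).1⟩

theorem diagram_isQuasiplanar [BoundedOrder P] (h : IsConjugate r) :
    h.diagram.IsQuasiplanar where
  left_of_every _ _ hxy _ hC hy := (h.diagram_onLeft (h.diagram_lft.1 hxy) hC hy).1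
  lft_iff_rght _ _ := h.diagram_lft.trans h.diagram_rght.symm

end IsConjugate

/-! ### Planarity of the rank drawing of a lattice -/

/-- Both segments lie on the ray from b through p, so the nearer of the ends a, a' is inside the
other segment. -/
theorem mem_openSegment_of_mem_openSegment {E : Type*} [AddCommGroup E] [Module ℝ E] {a a' b p : E}
    (hp : p ∈ openSegment ℝ a b) (hp' : p ∈ openSegment ℝ a' b) (hne : a ≠ a') :
    a ∈ openSegment ℝ a' b ∨ a' ∈ openSegment ℝ a b := by
  have key : ∀ {a a' : E} {s t s' t' : ℝ}, 0 < s → 0 < s' → s + t = 1 → s' + t' = 1 →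
      s • a + t • b = s' • a' + t' • b → s' < s → a ∈ openSegment ℝ a' b := by
    intro a a' s t s' t' hs hs' hst hst' h hlt
    refine ⟨s' / s, (t' - t) / s, by positivity, div_pos (by linarith) hs, ?_, ?_⟩
    · field_simp
      linarith
    · have h₁ : s • a = s' • a' + (t' - t) • b := by
        rw [sub_smul, ← add_sub_assoc, ← h, add_sub_cancel_right]
      rw [← inv_smul_smul₀ hs.ne' a, h₁, smul_add, smul_smul, smul_smul, div_eq_inv_mul,
        div_eq_inv_mul]
  obtain ⟨s, t, hs, ht, hst, rfl⟩ := hp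
  obtain ⟨s', t', hs', ht', hst', h⟩ := hp'
  rcases lt_trichotomy s' s with hlt | rfl | hlt
  · exact Or.inl (key hs hs' hst hst' h.symm hlt)
  · obtain rfl : t = t' := by linarith
    exact absurd (smul_right_injective E hs.ne' (add_right_cancel h)).symm hne
  · exact Or.inr (key hs' hs hst' hst h hlt)

/-- At a crossing both lower ends are below both upper ends, so a ⊔ a' ≤ b ⊓ b'. The coverings then
force a common end, and edges with a common end that cross elsewhere put a vertex inside an edge. -/
theorem IsConjugate.diagram_isPlanar {L : Type*} [Lattice L] [Finite L] {r : L → L → Prop}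
    (h : IsConjugate r) : h.diagram.IsPlanar := by
  intro a b a' b' hab hab' hne
  rw [Set.disjoint_left]
  intro p hp hp'
  obtain ⟨⟨h₁, h₂⟩, h₃, h₄⟩ := h.add_sub_lt_of_mem_openSegment hab.lt hp
  obtain ⟨⟨h₁', h₂'⟩, h₃', h₄'⟩ := h.add_sub_lt_of_mem_openSegment hab'.lt hp'
  have hab'_lt : a < b' := lt_of_le_not_ge
    (h.le_iff_point.2 ⟨(h₁.trans h₂').le, (h₃.trans h₄').le⟩)
    fun hle => absurd (h.le_iff_point.1 hle).1 (not_le.2 (h₁.trans h₂'))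
  have ha'b_lt : a' < b := lt_of_le_not_ge
    (h.le_iff_point.2 ⟨(h₁'.trans h₂).le, (h₃'.trans h₄).le⟩)
    fun hle => absurd (h.le_iff_point.1 hle).1 (not_le.2 (h₁'.trans h₂))
  have hbot : b ≠ b' → a = a' := by
    intro hbb
    have haa : a ⊔ a' ≤ b ⊓ b' := le_inf (sup_le hab.le ha'b_lt.le) (sup_le hab'_lt.le hab'.le)
    rcases hab.eq_or_eq le_sup_left (haa.trans inf_le_left) with h₅ | h₅ <;>
      rcases hab'.eq_or_eq le_sup_right (haa.trans inf_le_right) with h₆ | h₆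
    · exact h₅.symm.trans h₆
    · exact absurd (h₅.symm.trans h₆) hab'_lt.ne
    · exact absurd (h₆.symm.trans h₅) ha'b_lt.ne
    · exact absurd (h₅.symm.trans h₆) hbb
  by_cases hbb : b = b'
  · subst hbb
    have haa : a ≠ a' := fun haa => hne (by rw [haa])
    rcases mem_openSegment_of_mem_openSegment hp hp' (h.point_injective.ne haa) with h' | h'
    · exact h.diagram.vertex_notMem_edge _ _ _ hab' h'
    · exact h.diagram.vertex_notMem_edge _ _ _ hab h'
  · obtain rfl := hbot hbb
    rw [openSegment_symm] at hp hp'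
    rcases mem_openSegment_of_mem_openSegment hp hp' (h.point_injective.ne hbb) with h' | h' <;>
      rw [openSegment_symm] at h'
    · exact h.diagram.vertex_notMem_edge _ _ _ hab' h'
    · exact h.diagram.vertex_notMem_edge _ _ _ hab h'

/-! ### The slim semimodular lattice of left pairs -/

namespace QuasiplanarDiagram

variable (Q : QuasiplanarDiagram.{u})

theorem isConjugate : IsConjugate Q.diagram.Lft := Q.isQuasiplanar.isConjugate

variable {Q}

theorem ne_bot_of_leftLE {r : Q.carrier → Q.carrier → Prop} (h : IsConjugate r) {x y : Q.carrier}
    (hx : x ≠ ⊥) (hxy : leftLE r x y) : y ≠ ⊥ := by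
  rintro rfl
  exact hx (h.le_antisymm hxy (Or.inl bot_le))

namespace LeftPair

theorem leftLE_fst_snd (s : LeftPair Q) : leftLE Q.diagram.Lft s.1.1 s.1.2 :=
  s.2.2.2.elim (fun h => Or.inl h.le) Or.inr

theorem leftLE_snd_fst (s : LeftPair Q) :
    leftLE (Function.swap Q.diagram.Lft) s.1.2 s.1.1 :=
  s.2.2.2.elim (fun h => Or.inl h.ge) Or.inr

instance : PartialOrder (LeftPair Q) where
  le := LeftPair.le
  le_refl s := ⟨Or.inl le_rfl, Or.inl le_rfl⟩
  le_trans _ _ _ h₁ h₂ :=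
    ⟨Q.isConjugate.le_trans h₁.1 h₂.1, Q.isConjugate.swap.le_trans h₁.2 h₂.2⟩
  le_antisymm _ _ h₁ h₂ := Subtype.ext (Prod.ext (Q.isConjugate.le_antisymm h₁.1 h₂.1)
    (Q.isConjugate.swap.le_antisymm h₁.2 h₂.2))

theorem le_def {s t : LeftPair Q} : s ≤ t ↔ leftLE Q.diagram.Lft s.1.1 t.1.1 ∧
    leftLE (Function.swap Q.diagram.Lft) s.1.2 t.1.2 := Iff.rfl

theorem lft_iff {s t : LeftPair Q} : s.lft t ↔
    (leftLE Q.diagram.Lft s.1.1 t.1.1 ∧ s.1.1 ≠ t.1.1) ∧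
      (leftLE (Function.swap Q.diagram.Lft) t.1.2 s.1.2 ∧ t.1.2 ≠ s.1.2) := by
  have key : ∀ {r : Q.carrier → Q.carrier → Prop}, IsConjugate r → ∀ x y : Q.carrier,
      (x < y ∨ r x y) ↔ leftLE r x y ∧ x ≠ y := by
    intro r h x y
    constructor
    · rintro (hxy | hxy)
      · exact ⟨Or.inl hxy.le, hxy.ne⟩
      · exact ⟨Or.inr hxy, (h.rel_iff.1 hxy).1⟩
    · rintro ⟨hxy | hxy, hne⟩
      · exact Or.inl (lt_of_le_of_ne hxy hne)
      · exact Or.inr hxy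
  exact and_congr (key Q.isConjugate _ _) (key Q.isConjugate.swap _ _)

-- The order is that of a product of two linear orders, where incomparability means that one
-- coordinate strictly increases and the other strictly decreases; the direction decides which pair
-- is on the left.
variable (Q) in
theorem isConjugate_lft : IsConjugate (LeftPair.lft (Q := Q)) where
  incomp {s t} hst := by
    rw [lft_iff] at hst
    exact ⟨fun h => hst.2.2 (Q.isConjugate.swap.le_antisymm hst.2.1 h.2),
      fun h => hst.1.2 (Q.isConjugate.le_antisymm hst.1.1 h.1)⟩
  total {s t} hst hts := by
    rw [le_def, not_and_or, Q.isConjugate.not_le_iff, Q.isConjugate.swap.not_le_iff] at hst hts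
    rw [lft_iff, lft_iff]
    rcases hst with hst | hst <;> rcases hts with hts | hts
    · exact absurd (Q.isConjugate.le_antisymm hst.1 hts.1) hst.2.symm
    · exact Or.inr ⟨⟨hst.1, hst.2.symm⟩, ⟨hts.1, hts.2.symm⟩⟩
    · exact Or.inl ⟨⟨hts.1, hts.2.symm⟩, ⟨hst.1, hst.2.symm⟩⟩
    · exact absurd (Q.isConjugate.swap.le_antisymm hst.1 hts.1) hst.2.symm
  trans {s t u} hst htu := by
    rw [lft_iff] at hst htu ⊢
    refine ⟨⟨Q.isConjugate.le_trans hst.1.1 htu.1.1, fun h => ?_⟩,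
      Q.isConjugate.swap.le_trans htu.2.1 hst.2.1, fun h => ?_⟩
    · exact hst.1.2 (Q.isConjugate.le_antisymm hst.1.1 (h ▸ htu.1.1))
    · exact hst.2.2 (Q.isConjugate.swap.le_antisymm hst.2.1 (h ▸ htu.2.1))

/-- The elements above both components in the respective linear orders. -/
def filter (s : LeftPair Q) : Set Q.carrier :=
  {z | leftLE Q.diagram.Lft s.1.1 z ∧ leftLE (Function.swap Q.diagram.Lft) s.1.2 z}

theorem fst_mem_filter (s : LeftPair Q) : s.1.1 ∈ s.filter :=
  ⟨Or.inl le_rfl, s.leftLE_snd_fst⟩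

theorem snd_mem_filter (s : LeftPair Q) : s.1.2 ∈ s.filter :=
  ⟨s.leftLE_fst_snd, Or.inl le_rfl⟩

theorem le_iff_filter_subset {s t : LeftPair Q} : s ≤ t ↔ t.filter ⊆ s.filter :=
  ⟨fun h _ hz => ⟨Q.isConjugate.le_trans h.1 hz.1, Q.isConjugate.swap.le_trans h.2 hz.2⟩,
    fun h => ⟨(h t.fst_mem_filter).1, (h t.snd_mem_filter).2⟩⟩

theorem filter_injective : Function.Injective (filter (Q := Q)) := fun _ _ h =>
  le_antisymm (le_iff_filter_subset.2 h.ge) (le_iff_filter_subset.2 h.le)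

theorem bot_notMem_filter (s : LeftPair Q) : ⊥ ∉ s.filter := fun h =>
  ne_bot_of_leftLE Q.isConjugate s.2.1 h.1 rfl

theorem top_mem_filter (s : LeftPair Q) : ⊤ ∈ s.filter := ⟨Or.inl le_top, Or.inl le_top⟩

theorem isHcoFilter_filter (s : LeftPair Q) : Q.IsHcoFilter s.filter where
  nonempty := ⟨⊤, s.top_mem_filter⟩
  bot_notMem := s.bot_notMem_filter
  isUpperSet _ _ hxy hx :=
    ⟨Q.isConjugate.le_trans hx.1 (Or.inl hxy), Q.isConjugate.swap.le_trans hx.2 (Or.inl hxy)⟩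
  horizontallyConvex _ _ _ hxy hyz hx hz :=
    ⟨Q.isConjugate.le_trans hx.1 (Or.inr hxy), Q.isConjugate.swap.le_trans hz.2 (Or.inr hyz)⟩

/-- The pair consists of the least elements of A in the two linear orders. If they differ, the two
orders compare them oppositely, so the first is on the left of the second. -/
theorem exists_forall_leftLE {A : Set Q.carrier} (hA : A.Nonempty) (hbot : ⊥ ∉ A) :
    ∃ s : LeftPair Q, s.1.1 ∈ A ∧ s.1.2 ∈ A ∧ A ⊆ s.filter := by
  obtain ⟨x, hx, hxA⟩ := Q.isConjugate.exists_least hA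
  obtain ⟨y, hy, hyA⟩ := Q.isConjugate.swap.exists_least hA
  refine ⟨⟨(x, y), fun h : x = ⊥ => hbot (h ▸ hx), fun h : y = ⊥ => hbot (h ▸ hy), ?_⟩, hx, hy,
    fun z hz => ⟨hxA z hz, hyA z hz⟩⟩
  by_cases h : x = y
  · exact Or.inl h
  · exact Or.inr (Q.isConjugate.rel_iff.2 ⟨h, hxA y hy, hyA x hx⟩)

theorem exists_filter_eq {X : Set Q.carrier} (hX : Q.IsHcoFilter X) :
    ∃ s : LeftPair Q, s.filter = X := by
  obtain ⟨s, h₁, h₂, hs⟩ := exists_forall_leftLE hX.nonempty hX.bot_notMem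
  refine ⟨s, Set.Subset.antisymm ?_ hs⟩
  -- An element beyond both least elements is above one of them or horizontally between them.
  rintro z ⟨hz₁ | hz₁, hz₂⟩
  · exact hX.isUpperSet hz₁ h₁
  rcases hz₂ with hz₂ | hz₂
  · exact hX.isUpperSet hz₂ h₂
  · exact hX.horizontallyConvex _ _ _ hz₁ hz₂ h₁ h₂

/-- Left pairs correspond to proper horizontally convex order filters. -/
noncomputable def filterEquiv : LeftPair Q ≃ HcoFilter Q :=
  Equiv.ofBijective (fun s => ⟨s.filter, s.isHcoFilter_filter⟩)
    ⟨fun _ _ h => filter_injective (congrArg Subtype.val h), fun X =>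
      (exists_filter_eq X.2).imp fun _ h => Subtype.ext h⟩

theorem filterEquiv_val (s : LeftPair Q) : (filterEquiv s).1 = s.filter := rfl

theorem filter_filterEquiv_symm (X : HcoFilter Q) : (filterEquiv.symm X).filter = X.1 := by
  rw [← filterEquiv_val, Equiv.apply_symm_apply]

theorem exists_filter_eq_inter (s t : LeftPair Q) :
    ∃ u : LeftPair Q, u.filter = s.filter ∩ t.filter :=
  exists_filter_eq
    { nonempty := ⟨⊤, s.top_mem_filter, t.top_mem_filter⟩
      bot_notMem := fun h => s.bot_notMem_filter h.1
      isUpperSet := s.isHcoFilter_filter.isUpperSet.inter t.isHcoFilter_filter.isUpperSet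
      horizontallyConvex := fun _ _ _ hxy hyz hx hz =>
        ⟨s.isHcoFilter_filter.horizontallyConvex _ _ _ hxy hyz hx.1 hz.1,
          t.isHcoFilter_filter.horizontallyConvex _ _ _ hxy hyz hx.2 hz.2⟩ }

theorem exists_isGLB (s t : LeftPair Q) : ∃ u : LeftPair Q,
    (u.1.1 = s.1.1 ∨ u.1.1 = t.1.1) ∧ (u.1.2 = s.1.2 ∨ u.1.2 = t.1.2) ∧ u ≤ s ∧ u ≤ t := by
  obtain ⟨x, hx, hxA⟩ := Q.isConjugate.exists_least (A := {s.1.1, t.1.1}) ⟨_, Or.inl rfl⟩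
  obtain ⟨y, hy, hyA⟩ := Q.isConjugate.swap.exists_least (A := {s.1.2, t.1.2}) ⟨_, Or.inl rfl⟩
  have hxy : x = y ∨ Q.diagram.Lft x y := by
    by_cases h : x = y
    · exact Or.inl h
    refine Or.inr (Q.isConjugate.rel_iff.2 ⟨h, ?_, ?_⟩)
    · rcases hy with rfl | rfl
      · exact Q.isConjugate.le_trans (hxA _ (Or.inl rfl)) s.leftLE_fst_snd
      · exact Q.isConjugate.le_trans (hxA _ (Or.inr rfl)) t.leftLE_fst_snd
    · rcases hx with rfl | rfl
      · exact Q.isConjugate.swap.le_trans (hyA _ (Or.inl rfl)) s.leftLE_snd_fst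
      · exact Q.isConjugate.swap.le_trans (hyA _ (Or.inr rfl)) t.leftLE_snd_fst
  refine ⟨⟨(x, y), ?_, ?_, hxy⟩, hx, hy, ⟨hxA _ (Or.inl rfl), hyA _ (Or.inl rfl)⟩,
    ⟨hxA _ (Or.inr rfl), hyA _ (Or.inr rfl)⟩⟩
  · rcases hx with rfl | rfl
    exacts [s.2.1, t.2.1]
  · rcases hy with rfl | rfl
    exacts [s.2.2.1, t.2.2.1]

noncomputable instance : Lattice (LeftPair Q) where
  sup s t := (exists_filter_eq_inter s t).choose
  inf s t := (exists_isGLB s t).choose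
  le_sup_left s t := by
    rw [le_iff_filter_subset, (exists_filter_eq_inter s t).choose_spec]
    exact Set.inter_subset_left
  le_sup_right s t := by
    rw [le_iff_filter_subset, (exists_filter_eq_inter s t).choose_spec]
    exact Set.inter_subset_right
  sup_le s t u hsu htu := by
    rw [le_iff_filter_subset] at hsu htu ⊢
    rw [(exists_filter_eq_inter s t).choose_spec]
    exact Set.subset_inter hsu htu
  inf_le_left s t := (exists_isGLB s t).choose_spec.2.2.1
  inf_le_right s t := (exists_isGLB s t).choose_spec.2.2.2
  le_inf u s t hs ht := by
    obtain ⟨h₁, h₂, -⟩ := (exists_isGLB s t).choose_spec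
    rw [le_def]
    exact ⟨h₁.elim (fun h => h.symm ▸ hs.1) fun h => h.symm ▸ ht.1,
      h₂.elim (fun h => h.symm ▸ hs.2) fun h => h.symm ▸ ht.2⟩

theorem filter_sup (s t : LeftPair Q) : (s ⊔ t).filter = s.filter ∩ t.filter :=
  (exists_filter_eq_inter s t).choose_spec

theorem inf_fst (s t : LeftPair Q) : (s ⊓ t).1.1 = s.1.1 ∨ (s ⊓ t).1.1 = t.1.1 :=
  (exists_isGLB s t).choose_spec.1

/-- The diagonal pair of a nonzero element. -/
def diag (x : Q.carrier) (hx : x ≠ ⊥) : LeftPair Q := ⟨(x, x), hx, hx, Or.inl rfl⟩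

instance : Finite (LeftPair Q) := Subtype.finite

instance : Nonempty (LeftPair Q) := ⟨diag ⊤ top_ne_bot⟩

/-- Some component of s is missing from the filter of t, since otherwise t ≤ s. Being least in one
linear order, it can be deleted from the filter of s without losing convexity, and the covering
makes the result the filter of t. -/
theorem exists_filter_eq_insert {s t : LeftPair Q} (hst : s ⋖ t) :
    ∃ p, s.filter = insert p t.filter := by
  suffices h : ∃ p ∈ s.filter, p ∉ t.filter ∧ Q.IsHcoFilter (s.filter \ {p}) by
    obtain ⟨p, hps, hpt, hX⟩ := h
    refine ⟨p, ?_⟩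
    obtain ⟨u, hu⟩ := exists_filter_eq hX
    have hsu : s < u := lt_of_le_not_ge (le_iff_filter_subset.2 (hu ▸ Set.sdiff_subset))
      fun h => ((hu ▸ le_iff_filter_subset.1 h) hps : p ∈ s.filter \ {p}).2 rfl
    have hut : u ≤ t := le_iff_filter_subset.2 <| hu ▸ fun z hz =>
      ⟨le_iff_filter_subset.1 hst.le hz, fun h : z = p => hpt (h ▸ hz)⟩
    obtain rfl : u = t := hut.eq_of_not_lt (hst.2 hsu)
    rw [hu, Set.insert_sdiff_singleton, Set.insert_eq_of_mem hps]
  have hco : ∀ p, p ≠ ⊤ → (∀ x y, x ≤ y → x ∈ s.filter \ {p} → y ≠ p) →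
      (∀ x y z, Q.diagram.Lft x y → Q.diagram.Lft y z → x ∈ s.filter \ {p} →
        z ∈ s.filter \ {p} → y ≠ p) → Q.IsHcoFilter (s.filter \ {p}) := fun p hp h₁ h₂ =>
    { nonempty := ⟨⊤, s.top_mem_filter, hp.symm⟩
      bot_notMem := fun h => s.bot_notMem_filter h.1
      isUpperSet := fun x y hxy hx => ⟨s.isHcoFilter_filter.isUpperSet hxy hx.1, h₁ x y hxy hx⟩
      horizontallyConvex := fun x y z hxy hyz hx hz =>
        ⟨s.isHcoFilter_filter.horizontallyConvex _ _ _ hxy hyz hx.1 hz.1,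
          h₂ x y z hxy hyz hx hz⟩ }
  by_cases h₁ : s.1.1 ∈ t.filter
  · have h₂ : s.1.2 ∉ t.filter := fun h₂ => hst.lt.not_ge ⟨h₁.1, h₂.2⟩
    refine ⟨_, s.snd_mem_filter, h₂, hco _ (fun h => h₂ (h ▸ t.top_mem_filter)) ?_ ?_⟩
    · rintro x y hxy ⟨hx, hne⟩ rfl
      exact hne (Q.isConjugate.swap.le_antisymm (Or.inl hxy) hx.2)
    · rintro x y z - hyz - ⟨hz, hne⟩ rfl
      exact hne (Q.isConjugate.swap.le_antisymm (Or.inr hyz) hz.2)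
  · refine ⟨_, s.fst_mem_filter, h₁, hco _ (fun h => h₁ (h ▸ t.top_mem_filter)) ?_ ?_⟩
    · rintro x y hxy ⟨hx, hne⟩ rfl
      exact hne (Q.isConjugate.le_antisymm (Or.inl hxy) hx.1)
    · rintro x y z hxy - ⟨hx, hne⟩ - rfl
      exact hne (Q.isConjugate.le_antisymm (Or.inr hxy) hx.1)

instance : IsUpperModularLattice (LeftPair Q) where
  covBy_sup_of_inf_covBy {a b} hab := by
    obtain ⟨p, hp⟩ := exists_filter_eq_insert hab
    have hba : ¬ a ≤ b := fun h => hab.lt.ne (inf_eq_left.2 h)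
    refine ⟨lt_of_le_not_ge le_sup_right fun h => hba (le_sup_left.trans h), fun c hbc hc => ?_⟩
    -- Thus the filters of b and of a ⊔ b, the latter being the intersection, differ at most in p.
    have hsub : b.filter ⊆ insert p a.filter := hp ▸ le_iff_filter_subset.1 inf_le_right
    by_cases hpc : p ∈ c.filter
    · refine hbc.not_ge (le_iff_filter_subset.2 fun z hz => ?_)
      rcases hsub hz with rfl | hza
      · exact hpc
      · exact le_iff_filter_subset.1 hc.le (by rw [filter_sup]; exact ⟨hza, hz⟩)
    · refine hc.not_ge (le_iff_filter_subset.2 fun z hz => ?_)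
      have hzb := le_iff_filter_subset.1 hbc.le hz
      rw [filter_sup]
      refine ⟨(hsub hzb).resolve_left ?_, hzb⟩
      rintro rfl
      exact hpc hz

-- The two chains are the pairs whose filters are final segments of one of the linear orders. Every
-- filter is the intersection of two such segments, so every pair is a join of members of the two
-- chains.
variable (Q) in
theorem isSlim : IsSlim (LeftPair Q) := by
  refine ⟨{s | ∀ z, leftLE Q.diagram.Lft s.1.1 z → z ∈ s.filter},
    {s | ∀ z, leftLE (Function.swap Q.diagram.Lft) s.1.2 z → z ∈ s.filter}, ?_, ?_, ?_⟩
  · intro s hs t ht _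
    refine (Q.isConjugate.le_total s.1.1 t.1.1).imp (fun h => ?_) fun h => ?_
    · exact ⟨h, (hs _ (Q.isConjugate.le_trans h t.leftLE_fst_snd)).2⟩
    · exact ⟨h, (ht _ (Q.isConjugate.le_trans h s.leftLE_fst_snd)).2⟩
  · intro s hs t ht _
    refine (Q.isConjugate.swap.le_total s.1.2 t.1.2).imp (fun h => ?_) fun h => ?_
    · exact ⟨(hs _ (Q.isConjugate.swap.le_trans h t.leftLE_snd_fst)).1, h⟩
    · exact ⟨(ht _ (Q.isConjugate.swap.le_trans h s.leftLE_snd_fst)).1, h⟩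
  · intro s hs
    obtain ⟨l, hl₁, hl₂, hl⟩ := exists_forall_leftLE
      (A := {z | leftLE Q.diagram.Lft s.1.1 z}) ⟨_, Or.inl le_rfl⟩
      fun h => ne_bot_of_leftLE Q.isConjugate s.2.1 h rfl
    obtain ⟨m, hm₁, hm₂, hm⟩ := exists_forall_leftLE
      (A := {z | leftLE (Function.swap Q.diagram.Lft) s.1.2 z}) ⟨_, Or.inl le_rfl⟩
      fun h => ne_bot_of_leftLE Q.isConjugate.swap s.2.2.1 h rfl
    have hls : l ≤ s := ⟨(hl (Or.inl le_rfl)).1, (hl s.leftLE_fst_snd).2⟩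
    have hms : m ≤ s := ⟨(hm s.leftLE_snd_fst).1, (hm (Or.inl le_rfl)).2⟩
    have hsup : l ⊔ m = s := by
      refine le_antisymm (sup_le hls hms) ⟨?_, ?_⟩
      · exact Q.isConjugate.le_trans hl₁ (le_sup_left (a := l) (b := m)).1
      · exact Q.isConjugate.swap.le_trans hm₂ (le_sup_right (a := l) (b := m)).2
    rcases hs.2 hsup with rfl | rfl
    · exact Or.inl fun z hz => hl (show leftLE _ _ _ from hz)
    · exact Or.inr fun z hz => hm (show leftLE _ _ _ from hz)

/-- A pair (x, y) with x ≠ y is the meet of (x, x) and (y, y). Conversely, a meet takes its first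
component from one factor, and the only pair above (x, x) with first component x is (x, x) itself.
-/
theorem infIrred_or_isTop_iff {s : LeftPair Q} : InfIrred s ∨ IsTop s ↔ s.1.1 = s.1.2 := by
  constructor
  · intro h
    by_contra hne
    have hl := Q.isConjugate.rel_iff.2 ⟨hne, s.leftLE_fst_snd, s.leftLE_snd_fst⟩
    rcases h with h | h
    · have hle₁ : s ≤ diag s.1.1 s.2.1 := ⟨Or.inl le_rfl, s.leftLE_snd_fst⟩
      have hle₂ : s ≤ diag s.1.2 s.2.2.1 := ⟨s.leftLE_fst_snd, Or.inl le_rfl⟩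
      have hinf : diag s.1.1 s.2.1 ⊓ diag s.1.2 s.2.2.1 = s :=
        le_antisymm (le_def.2
          ⟨(inf_le_left (a := diag s.1.1 s.2.1) (b := diag s.1.2 s.2.2.1)).1,
            (inf_le_right (a := diag s.1.1 s.2.1) (b := diag s.1.2 s.2.2.1)).2⟩)
          (le_inf hle₁ hle₂)
      rcases h.2 hinf with h | h
      · exact hne (congrArg (fun t : LeftPair Q => t.1.2) h)
      · exact hne (congrArg (fun t : LeftPair Q => t.1.1) h).symm
    · have h' := h (diag ⊤ top_ne_bot)
      refine (Q.isConjugate.incomp hl).2 ?_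
      rw [Q.isConjugate.le_antisymm (Or.inl le_top) h'.1]
      exact le_top
  · intro hs
    rw [or_iff_not_imp_right]
    intro htop
    have hmax : ¬ IsMax s := fun h => htop fun t => le_sup_right.trans (h le_sup_left)
    refine ⟨hmax, fun a b hab => ?_⟩
    have key : ∀ a : LeftPair Q, s ≤ a → s.1.1 = a.1.1 → a = s := fun a ha h =>
      le_antisymm (le_def.2 ⟨Or.inl h.ge, by rw [← hs, h]; exact a.leftLE_snd_fst⟩) ha
    rcases inf_fst a b with h | h
    · exact Or.inl (key a (hab ▸ inf_le_left) (hab ▸ h))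
    · exact Or.inr (key b (hab ▸ inf_le_right) (hab ▸ h))

end LeftPair

variable (Q) in
theorem exists_isBetaOne : ∃ D : SlimSemimodularDiagram.{u}, Q.IsBetaOne D := by
  have := Fintype.ofFinite (LeftPair Q)
  have := Fintype.toBoundedOrder (LeftPair Q)
  refine ⟨{ carrier := LeftPair Q
            diagram := (LeftPair.isConjugate_lft Q).diagram
            isPlanar := (LeftPair.isConjugate_lft Q).diagram_isPlanar
            isSlim := LeftPair.isSlim Q
            semimodular := inferInstance }, Equiv.refl _, fun _ _ => Iff.rfl, fun _ _ => ?_⟩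
  exact (LeftPair.isConjugate_lft Q).diagram_lft

end QuasiplanarDiagram

/-- One implication suffices, since each incomparable pair is related in exactly one direction. -/
theorem IsConjugate.rel_iff_of_imp {P P' : Type*} [PartialOrder P] [PartialOrder P']
    {r : P → P → Prop} {r' : P' → P' → Prop} (h : IsConjugate r) (h' : IsConjugate r')
    (e : P → P') (he : ∀ x y, x ≤ y ↔ e x ≤ e y) (himp : ∀ x y, r x y → r' (e x) (e y))
    (x y : P) : r x y ↔ r' (e x) (e y) := by
  refine ⟨himp x y, fun hxy => ?_⟩
  obtain ⟨h₁, h₂⟩ := h'.incomp hxy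
  rw [← he] at h₁ h₂
  exact (h.total h₁ h₂).resolve_right fun hyx => h'.asymm hxy (himp y x hyx)

theorem OrderIso.infIrred_or_isTop_iff {L L' : Type*} [Lattice L] [Lattice L'] (e : L ≃o L')
    {x : L} : InfIrred (e x) ∨ IsTop (e x) ↔ InfIrred x ∨ IsTop x := by
  refine or_congr ?_ ?_
  · refine and_congr (not_congr ?_) ⟨fun h a b hab => ?_, fun h a b hab => ?_⟩
    · exact e.isMax_apply
    · have := h (b := e a) (c := e b) (by rw [← e.map_inf, hab])
      simpa using this
    · have := h (b := e.symm a) (c := e.symm b) (by rw [← e.symm.map_inf, hab, e.symm_apply_apply])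
      simpa [e.symm_apply_eq] using this
  · exact ⟨fun h a => e.le_iff_le.1 (h (e a)), fun h a => e.symm_apply_le.1 (h _)⟩

/-! ### Meet-irreducible elements of slim semimodular lattices -/

section SlimSemimodular

variable {L : Type*} [Lattice L]

/-- The covering gives b ⊓ e = d, so semimodularity applies. -/
theorem covBy_sup_of_covBy_of_not_le [IsUpperModularLattice L] {b d e : L} (hb : d ⋖ b) (he : d ≤ e) (hbe : ¬ b ≤ e) :
    e ⋖ b ⊔ e := by
  refine covBy_sup_of_inf_covBy_left ?_
  rwa [(hb.eq_or_eq (le_inf hb.le he) inf_le_left).resolve_right fun h => hbe (inf_eq_left.1 h)]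

variable [Finite L]

theorem exists_supIrred_le_not_le {a d : L} (h : ¬ a ≤ d) : ∃ j, SupIrred j ∧ j ≤ a ∧ ¬ j ≤ d := by
  have := Fintype.ofFinite L
  have : Nonempty L := ⟨a⟩
  have := Fintype.toBoundedOrder L
  obtain ⟨s, rfl, hs⟩ := exists_supIrred_decomposition a
  by_contra! hj
  exact h (Finset.sup_le fun j hjs => hj j (hs hjs) (Finset.le_sup (f := id) hjs))

theorem exists_infIrred_le_not_le {a d : L} (h : ¬ d ≤ a) : ∃ m, InfIrred m ∧ a ≤ m ∧ ¬ d ≤ m := by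
  have := Fintype.ofFinite L
  have : Nonempty L := ⟨a⟩
  have := Fintype.toBoundedOrder L
  obtain ⟨s, rfl, hs⟩ := exists_infIrred_decomposition a
  by_contra! hj
  exact h (Finset.le_inf fun j hjs => hj j (hs hjs) (Finset.inf_le (f := id) hjs))

/-- In a slim lattice no element has three upper covers. -/
theorem IsSlim.eq_or_eq_or_eq_of_covBy (hL : IsSlim L) {d a b c : L} (ha : d ⋖ a) (hb : d ⋖ b)
    (hc : d ⋖ c) : a = b ∨ a = c ∨ b = c := by
  obtain ⟨C₁, C₂, h₁, h₂, hsub⟩ := hL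
  obtain ⟨i, hi, hia, hid⟩ := exists_supIrred_le_not_le ha.lt.not_ge
  obtain ⟨j, hj, hjb, hjd⟩ := exists_supIrred_le_not_le hb.lt.not_ge
  obtain ⟨k, hk, hkc, hkd⟩ := exists_supIrred_le_not_le hc.lt.not_ge
  -- Each cover has a join-irreducible below it that is not below d, and two of the three lie in one
  -- chain. The smaller of these, joined with d, gives both covers.
  have le : ∀ {a b i j : L}, d ⋖ a → d ⋖ b → i ≤ a → ¬ i ≤ d → j ≤ b → i ≤ j → a = b := by
    intro a b i j ha hb hia hid hjb hij
    have hai : d ⊔ i = a := (ha.eq_or_eq le_sup_left (sup_le ha.le hia)).resolve_left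
      fun h => hid (sup_eq_left.1 h)
    have hbi : d ⊔ i = b := (hb.eq_or_eq le_sup_left (sup_le hb.le (hij.trans hjb))).resolve_left
      fun h => hid (sup_eq_left.1 h)
    exact hai.symm.trans hbi
  have key : ∀ {C : Set L}, IsChain (· ≤ ·) C → ∀ {a b i j : L}, d ⋖ a → d ⋖ b → i ≤ a → ¬ i ≤ d →
      j ≤ b → ¬ j ≤ d → i ∈ C → j ∈ C → a = b := by
    intro C hC a b i j ha hb hia hid hjb hjd hi hj
    rcases hC.total hi hj with h | h
    · exact le ha hb hia hid hjb h
    · exact (le hb ha hjb hjd hia h).symm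
  rcases hsub hi with hi | hi <;> rcases hsub hj with hj | hj <;> rcases hsub hk with hk | hk
  · exact Or.inl (key h₁ ha hb hia hid hjb hjd hi hj)
  · exact Or.inl (key h₁ ha hb hia hid hjb hjd hi hj)
  · exact Or.inr (Or.inl (key h₁ ha hc hia hid hkc hkd hi hk))
  · exact Or.inr (Or.inr (key h₂ hb hc hjb hjd hkc hkd hj hk))
  · exact Or.inr (Or.inr (key h₁ hb hc hjb hjd hkc hkd hj hk))
  · exact Or.inr (Or.inl (key h₂ ha hc hia hid hkc hkd hi hk))
  · exact Or.inl (key h₂ ha hb hia hid hjb hjd hi hj)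
  · exact Or.inl (key h₂ ha hb hia hid hjb hjd hi hj)

variable [IsUpperModularLattice L]

/-- In a slim semimodular lattice, for `b` covering `d` there is only one meet-irreducible element
above `d` but not above `b`. -/
theorem IsSlim.infIrred_unique (hL : IsSlim L) {b d m n : L} (hb : d ⋖ b) (hm : InfIrred m)
    (hn : InfIrred n) (hdm : d ≤ m) (hdn : d ≤ n) (hbm : ¬ b ≤ m) (hbn : ¬ b ≤ n) : m = n := by
  -- If m < n, then m = (b ⊔ m) ⊓ n because m ⋖ b ⊔ m, contradicting irreducibility.
  have lt : ∀ {m n : L}, InfIrred m → d ≤ m → ¬ b ≤ m → ¬ b ≤ n → ¬ m < n := by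
    intro m n hm hdm hbm hbn hmn
    have hcov := covBy_sup_of_covBy_of_not_le hb hdm hbm
    have hmeet : (b ⊔ m) ⊓ n = m :=
      (hcov.eq_or_eq (le_inf le_sup_right hmn.le) inf_le_left).resolve_right fun h =>
        hbn (le_sup_left.trans (inf_eq_left.1 h))
    exact (hm.2 hmeet).elim hcov.lt.ne' hmn.ne'
  by_contra hne
  have hmn : ¬ m ≤ n := fun h => lt hm hdm hbm hbn (lt_of_le_of_ne h hne)
  have hnm : ¬ n ≤ m := fun h => lt hn hdn hbn hbm (lt_of_le_of_ne h (Ne.symm hne))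
  have hbe : ¬ b ≤ m ⊓ n := fun h => hbm (h.trans inf_le_left)
  -- For incomparable m and n the meet m ⊓ n would have three upper covers: one above b, one below
  -- m, one below n.
  have hcov := covBy_sup_of_covBy_of_not_le hb (le_inf hdm hdn) hbe
  obtain ⟨a₁, ha₁, ha₁m⟩ := exists_covBy_le_of_lt (inf_lt_left.2 hmn)
  obtain ⟨a₂, ha₂, ha₂n⟩ := exists_covBy_le_of_lt (inf_lt_right.2 hnm)
  rcases hL.eq_or_eq_or_eq_of_covBy hcov ha₁ ha₂ with h | h | h
  · exact hbm (le_sup_left.trans (h.le.trans ha₁m))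
  · exact hbn (le_sup_left.trans (h.le.trans ha₂n))
  · exact ha₁.lt.not_ge (le_inf ha₁m (h.le.trans ha₂n))

/-- The first of two incomparable meet-irreducible elements is the first among the
meet-irreducible elements above their meet. -/
theorem IsSlim.leftLE_of_inf_le (hL : IsSlim L) {r : L → L → Prop} (h : IsConjugate r) {m m' n : L}
    (hm : InfIrred m ∨ IsTop m) (hn : InfIrred n ∨ IsTop n) (hmm : r m m') (hle : m ⊓ m' ≤ n) :
    leftLE r m n := by
  rcases hn with hn | hn
  swap
  · exact Or.inl (hn m)
  replace hm := hm.resolve_right fun hm => (h.incomp hmm).2 (hm m')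
  by_contra hmn
  obtain ⟨hnm, hne⟩ := h.not_le_iff.1 hmn
  -- As m is the only meet-irreducible above m ⊓ m' but not above b, n ≠ m lies above b. With n
  -- before m before m', betweenness would put m above b too.
  obtain ⟨b, hb, hbm'⟩ := exists_covBy_le_of_lt (inf_lt_right.2 (h.incomp hmm).2)
  have hbm : ¬ b ≤ m := fun hbm => hb.lt.not_ge (le_inf hbm hbm')
  have hbn : b ≤ n := by
    by_contra hbn
    exact hne (hL.infIrred_unique hb hm hn inf_le_left hle hbm hbn)
  exact hbm (h.le_of_between hbn hbm' hnm (Or.inr hmm))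

end SlimSemimodular

/-! ### The diagram α(D) and the isomorphism of D with β₁(α(D)) -/

namespace SlimSemimodularDiagram

variable {D : SlimSemimodularDiagram.{u}} {Q : QuasiplanarDiagram.{u}}

instance : IsUpperModularLattice D.carrier := D.semimodular

variable (D) in
theorem isConjugate : IsConjugate D.diagram.Lft := by
  have := Fintype.ofFinite D.carrier
  have := Fintype.toBoundedOrder D.carrier
  exact D.isPlanar.isQuasiplanar.isConjugate

theorem isAlpha_iff : D.IsAlpha Q ↔ ∃ f : D.MirTop → Q.carrier, (∀ x, f x ≠ ⊥) ∧
    (∀ q, q ≠ ⊥ → ∃ x, f x = q) ∧ (∀ x y, f x ≤ f y ↔ x ≤ y) ∧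
    ∀ x y, Q.diagram.Lft (f x) (f y) ↔ D.diagram.Lft x.1 y.1 := by
  constructor
  · rintro ⟨e, he⟩
    refine ⟨fun x => e x, fun x hx => ?_, fun q hq => ?_, fun x y => ?_, he⟩
    · rw [← e.map_bot, e.apply_eq_iff_eq] at hx
      exact WithBot.coe_ne_bot hx
    · have hq' : e.symm q ≠ ⊥ := fun h => hq (by rw [← e.apply_symm_apply q, h, e.map_bot])
      obtain ⟨x, hx⟩ := WithBot.ne_bot_iff_exists.1 hq'
      exact ⟨x, by simp only [hx, e.apply_symm_apply]⟩
    · rw [e.le_iff_le, WithBot.coe_le_coe]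
  · rintro ⟨f, hbot, hsurj, hle, hlft⟩
    let g : WithBot D.MirTop → Q.carrier := WithBot.recBotCoe ⊥ f
    have hg : ∀ {x y : WithBot D.MirTop}, g x ≤ g y ↔ x ≤ y := by
      intro x y
      induction x with
      | bot => exact ⟨fun _ => bot_le, fun _ => bot_le⟩
      | coe x =>
        induction y with
        | bot => exact ⟨fun h => absurd (le_bot_iff.1 h) (hbot x),
            fun h => absurd (le_bot_iff.1 h) WithBot.coe_ne_bot⟩
        | coe y => exact (hle x y).trans WithBot.coe_le_coe.symm
    refine ⟨RelIso.ofSurjective (OrderEmbedding.ofMapLEIff g fun _ _ => hg) fun q => ?_, hlft⟩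
    by_cases hq : q = ⊥
    · exact ⟨⊥, hq.symm⟩
    · obtain ⟨x, hx⟩ := hsurj q hq
      exact ⟨x, hx⟩

theorem exists_isTop : ∃ x : D.MirTop, IsTop x.1 := by
  have := Fintype.ofFinite D.carrier
  have := Fintype.toBoundedOrder D.carrier
  exact ⟨⟨⊤, Or.inr isTop_top⟩, isTop_top⟩

-- The new bottom is comparable with everything, so λ restricted to the meet-irreducibles and the
-- top stays conjugate, and the rank drawing realizes it.
variable (D) in
theorem exists_isAlpha : ∃ Q : QuasiplanarDiagram.{u}, D.IsAlpha Q := by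
  obtain ⟨t, ht⟩ := exists_isTop (D := D)
  let _ : OrderTop D.MirTop := { top := t, le_top := fun x => ht x.1 }
  have hr : IsConjugate fun x y : WithBot D.MirTop =>
      ∃ a b : D.MirTop, x = a ∧ y = b ∧ D.diagram.Lft a.1 b.1 :=
    { incomp := by
        rintro _ _ ⟨a, b, rfl, rfl, h⟩
        rw [WithBot.coe_le_coe, WithBot.coe_le_coe]
        exact D.isConjugate.incomp h
      total := by
        intro x y hxy hyx
        induction x with
        | bot => exact absurd bot_le hxy
        | coe x =>
          induction y with
          | bot => exact absurd bot_le hyx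
          | coe y =>
            rw [WithBot.coe_le_coe] at hxy hyx
            exact (D.isConjugate.total hxy hyx).imp (fun h => ⟨x, y, rfl, rfl, h⟩)
              fun h => ⟨y, x, rfl, rfl, h⟩
      trans := by
        rintro _ _ _ ⟨a, b, rfl, rfl, h⟩ ⟨b', c, hb, rfl, h'⟩
        obtain rfl := WithBot.coe_injective hb
        exact ⟨a, c, rfl, rfl, D.isConjugate.trans h h'⟩ }
  refine ⟨{ carrier := WithBot D.MirTop
            finite := inferInstanceAs (Finite (Option D.MirTop))
            nontrivial := inferInstanceAs (Nontrivial (WithBot D.MirTop))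
            diagram := hr.diagram
            isQuasiplanar := hr.diagram_isQuasiplanar }, OrderIso.refl _, fun x y => ?_⟩
  refine hr.diagram_lft.trans ⟨?_, fun h => ⟨x, y, rfl, rfl, h⟩⟩
  rintro ⟨a, b, ha, hb, h⟩
  obtain rfl := WithBot.coe_injective ha
  obtain rfl := WithBot.coe_injective hb
  exact h

theorem IsAlpha.similar {Q' : QuasiplanarDiagram.{u}} (h : D.IsAlpha Q) (h' : D.IsAlpha Q') :
    QuasiplanarDiagram.similar Q Q' := by
  obtain ⟨e, he⟩ := h
  obtain ⟨e', he'⟩ := h'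
  refine ⟨e.symm.trans e', fun x y => ?_⟩
  obtain ⟨x, rfl⟩ := e.surjective x
  obtain ⟨y, rfl⟩ := e.surjective y
  simp only [OrderIso.trans_apply, OrderIso.symm_apply_apply]
  induction x with
  | bot =>
    rw [e.map_bot, e'.map_bot]
    exact ⟨fun h => absurd bot_le h.1, fun h => absurd bot_le h.1⟩
  | coe x =>
    induction y with
    | bot =>
      rw [e.map_bot, e'.map_bot]
      exact ⟨fun h => absurd bot_le h.2.1, fun h => absurd bot_le h.2.1⟩
    | coe y => exact (he x y).trans (he' x y).symm

theorem IsAlpha.trans_similar {Q' : QuasiplanarDiagram.{u}} (h : D.IsAlpha Q)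
    (h' : QuasiplanarDiagram.similar Q Q') : D.IsAlpha Q' := by
  obtain ⟨e, he⟩ := h
  obtain ⟨ψ, hψ⟩ := h'
  exact ⟨e.trans ψ, fun x y => (hψ _ _).symm.trans (he x y)⟩

/-- The meet-irreducible elements above `d` form the filter of a left pair of `Q`. -/
theorem exists_filter_eq_of_infIrred {f : D.MirTop → Q.carrier} (hbot : ∀ x, f x ≠ ⊥)
    (hsurj : ∀ q, q ≠ ⊥ → ∃ x, f x = q) (hle : ∀ x y, f x ≤ f y ↔ x ≤ y)
    (hlft : ∀ x y, Q.diagram.Lft (f x) (f y) ↔ D.diagram.Lft x.1 y.1) (d : D.carrier) :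
    ∃ s : QuasiplanarDiagram.LeftPair Q, ∀ x, f x ∈ s.filter ↔ d ≤ x.1 := by
  have hinj : Function.Injective f := fun x y hxy =>
    le_antisymm ((hle _ _).1 hxy.le) ((hle _ _).1 hxy.ge)
  obtain ⟨t, ht⟩ := exists_isTop (D := D)
  have hX : Q.IsHcoFilter (f '' {x | d ≤ x.1}) := by
    refine ⟨⟨f t, t, ht d, rfl⟩, ?_, ?_, ?_⟩
    · rintro ⟨x, -, hx⟩
      exact hbot x hx
    · rintro _ q hq ⟨x, hx, rfl⟩
      obtain ⟨y, rfl⟩ := hsurj q fun h => hbot x (le_bot_iff.1 (h ▸ hq))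
      exact ⟨y, le_trans hx ((hle _ _).1 hq), rfl⟩
    · rintro _ q _ hxq hqy ⟨x, hx, rfl⟩ ⟨y, hy, rfl⟩
      obtain ⟨z, rfl⟩ := hsurj q fun h => hxq.2.1 (h ▸ bot_le)
      exact ⟨z, D.isConjugate.le_of_between hx hy (Or.inr ((hlft _ _).1 hxq))
        (Or.inr ((hlft _ _).1 hqy)), rfl⟩
  obtain ⟨s, hs⟩ := QuasiplanarDiagram.LeftPair.exists_filter_eq hX
  refine ⟨s, fun x => ?_⟩
  rw [hs, hinj.mem_set_image]
  rfl

open QuasiplanarDiagram in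
theorem IsAlpha.isBetaOne (h : D.IsAlpha Q) : Q.IsBetaOne D := by
  obtain ⟨f, hbot, hsurj, hle, hlft⟩ := isAlpha_iff.1 h
  choose g hg using exists_filter_eq_of_infIrred hbot hsurj hle hlft
  have hf : ∀ x y, leftLE Q.diagram.Lft (f x) (f y) ↔ leftLE D.diagram.Lft x.1 y.1 := fun x y =>
    or_congr (hle x y) (hlft x y)
  have hf' : ∀ x y, leftLE (Function.swap Q.diagram.Lft) (f x) (f y) ↔
      leftLE (Function.swap D.diagram.Lft) x.1 y.1 := fun x y => or_congr (hle x y) (hlft y x)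
  have hgle : ∀ d d' : D.carrier, d ≤ d' ↔ g d ≤ g d' := by
    intro d d'
    rw [LeftPair.le_iff_filter_subset]
    constructor
    · intro hd q hq
      obtain ⟨x, rfl⟩ := hsurj q fun h => (g d').bot_notMem_filter (h ▸ hq)
      exact (hg d x).2 (hd.trans ((hg d' x).1 hq))
    · intro hd
      by_contra hdd
      obtain ⟨m, hm, hdm, hdm'⟩ := exists_infIrred_le_not_le hdd
      exact hdm' ((hg d ⟨m, Or.inl hm⟩).1 (hd ((hg d' ⟨m, Or.inl hm⟩).2 hdm)))
  have hgsurj : Function.Surjective g := by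
    intro s
    obtain ⟨m, hm⟩ := hsurj _ s.2.1
    obtain ⟨m', hm'⟩ := hsurj _ s.2.2.1
    -- The preimage of (m, m') is m ⊓ m': what lies between m and m' is above the meet, and slimness
    -- gives the converse.
    refine ⟨m.1 ⊓ m'.1, LeftPair.filter_injective (Set.ext fun q => ?_)⟩
    have key : ∀ n : D.MirTop, f n ∈ s.filter ↔ m.1 ⊓ m'.1 ≤ n.1 := by
      intro n
      change leftLE _ _ _ ∧ leftLE _ _ _ ↔ _
      rw [← hm, ← hm', hf, hf']
      refine ⟨fun h => D.isConjugate.le_of_between inf_le_left inf_le_right h.1 h.2, fun hn => ?_⟩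
      rcases s.2.2.2 with h | h <;> rw [← hm, ← hm'] at h
      · obtain rfl := (le_antisymm ((hle _ _).1 h.le) ((hle _ _).1 h.ge))
        rw [inf_idem] at hn
        exact ⟨Or.inl hn, Or.inl hn⟩
      · rw [hlft] at h
        refine ⟨D.isSlim.leftLE_of_inf_le D.isConjugate m.2 n.2 h hn,
          D.isSlim.leftLE_of_inf_le D.isConjugate.swap m'.2 n.2 h ?_⟩
        rwa [inf_comm]
    by_cases hq : q = ⊥
    · rw [hq]
      exact iff_of_false (LeftPair.bot_notMem_filter _) (LeftPair.bot_notMem_filter _)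
    · obtain ⟨n, rfl⟩ := hsurj q hq
      rw [hg, key]
  have hginj : Function.Injective g := fun x y hxy =>
    le_antisymm ((hgle _ _).2 hxy.le) ((hgle _ _).2 hxy.ge)
  refine ⟨Equiv.ofBijective g ⟨hginj, hgsurj⟩, hgle,
    D.isConjugate.rel_iff_of_imp (LeftPair.isConjugate_lft Q) g hgle fun d d' hdd => ?_⟩
  obtain ⟨h₁, h₂⟩ := D.isConjugate.incomp hdd
  rw [hgle] at h₁ h₂
  -- If the images were in the opposite order, let n be the last component for d and m the first for
  -- d'. Then n λ d' ≤ m puts n weakly before m, whereas m strictly precedes the first component for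
  -- d, hence n.
  refine ((LeftPair.isConjugate_lft Q).total h₁ h₂).resolve_right fun hlt => ?_
  obtain ⟨⟨h₃, h₄⟩, h₅, h₆⟩ := LeftPair.lft_iff.1 hlt
  obtain ⟨m, hm⟩ := hsurj _ (g d').2.1
  obtain ⟨n, hn⟩ := hsurj _ (g d).2.2.1
  have hdn : d ≤ n.1 := (hg d n).1 (hn ▸ (g d).snd_mem_filter)
  have hd'm : d' ≤ m.1 := (hg d' m).1 (hm ▸ (g d').fst_mem_filter)
  have hd'n : ¬ d' ≤ n.1 := fun h => by
    have := (hg d' n).2 h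
    rw [hn] at this
    exact h₆ (Q.isConjugate.swap.le_antisymm h₅ this.2)
  have hnd' : D.diagram.Lft n.1 d' :=
    (D.isConjugate.swap.le_trans (Or.inr hdd) (Or.inl hdn)).resolve_left hd'n
  have hnm := (hf n m).2 (D.isConjugate.le_trans (Or.inr hnd') (Or.inl hd'm))
  rw [hn, hm] at hnm
  exact h₄ (Q.isConjugate.le_antisymm h₃
    (Q.isConjugate.le_trans (g d).leftLE_fst_snd hnm))

end SlimSemimodularDiagram

/-! ### Recovering Q from β₁(Q) -/

namespace QuasiplanarDiagram

variable {D : SlimSemimodularDiagram.{u}} {Q : QuasiplanarDiagram.{u}}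

theorem IsBetaOne.isAlpha (h : Q.IsBetaOne D) : D.IsAlpha Q := by
  obtain ⟨e, hle, hlft⟩ := h
  let e' : D.carrier ≃o LeftPair Q := ⟨e, fun {s t} => (hle s t).symm⟩
  have hdiag : ∀ x : D.MirTop, (e x.1).1.1 = (e x.1).1.2 := fun x =>
    LeftPair.infIrred_or_isTop_iff.1 (e'.infIrred_or_isTop_iff.2 x.2)
  -- Meet-irreducibles and the top are diagonal pairs, so either component gives the element of Q.
  refine SlimSemimodularDiagram.isAlpha_iff.2 ⟨fun x => (e x.1).1.1, fun x => (e x.1).2.1,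
    fun q hq => ?_, fun x y => ?_, fun x y => ?_⟩
  · have : InfIrred (e.symm (LeftPair.diag q hq)) ∨ IsTop (e.symm (LeftPair.diag q hq)) := by
      rw [← e'.infIrred_or_isTop_iff, LeftPair.infIrred_or_isTop_iff]
      change (e (e.symm _)).1.1 = (e (e.symm _)).1.2
      rw [e.apply_symm_apply]
      rfl
    exact ⟨⟨_, this⟩, congrArg (fun s : LeftPair Q => s.1.1) (e.apply_symm_apply _)⟩
  · rw [Q.isConjugate.le_iff, ← Subtype.coe_le_coe, hle]
    change _ ↔ leftLE Q.diagram.Lft (e x.1).1.1 (e y.1).1.1 ∧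
      leftLE (Function.swap Q.diagram.Lft) (e x.1).1.2 (e y.1).1.2
    rw [← hdiag x, ← hdiag y]
  · rw [hlft, LeftPair.lft_iff, Q.isConjugate.rel_iff, ← hdiag x, ← hdiag y]
    constructor
    · rintro ⟨h₁, h₂, h₃⟩
      exact ⟨⟨h₂, h₁⟩, h₃, h₁.symm⟩
    · rintro ⟨⟨h₂, h₁⟩, h₃, -⟩
      exact ⟨h₁, h₂, h₃⟩

theorem isBetaOne_iff : Q.IsBetaOne D ↔ D.IsAlpha Q :=
  ⟨IsBetaOne.isAlpha, SlimSemimodularDiagram.IsAlpha.isBetaOne⟩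

theorem IsBetaOne.similar {D' : SlimSemimodularDiagram.{u}} (h : Q.IsBetaOne D)
    (h' : Q.IsBetaOne D') : SlimSemimodularDiagram.similar D D' := by
  obtain ⟨e, hle, hlft⟩ := h
  obtain ⟨e', hle', hlft'⟩ := h'
  refine ⟨⟨e.trans e'.symm, fun {s t} => ?_⟩, fun s t => ?_⟩
  · rw [hle', hle]
    simp
  · rw [hlft', hlft]
    simp

theorem IsBetaOne.trans_similar {D' : SlimSemimodularDiagram.{u}} (h : Q.IsBetaOne D)
    (h' : SlimSemimodularDiagram.similar D' D) : Q.IsBetaOne D' := by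
  obtain ⟨e, hle, hlft⟩ := h
  obtain ⟨ψ, hψ⟩ := h'
  refine ⟨ψ.toEquiv.trans e, fun s t => ?_, fun s t => (hψ s t).trans (hlft _ _)⟩
  rw [← ψ.le_iff_le]
  exact hle _ _

end QuasiplanarDiagram

/-! ### Boundary chains and β₂ -/

namespace QuasiplanarDiagram

variable (Q : QuasiplanarDiagram.{u})

/-- The common form of the sequences of filters, for an arbitrary relation `r`. -/
inductive FilterSeq (r : Q.carrier → Q.carrier → Prop) : Set Q.carrier → Prop
  | base : FilterSeq r {⊤}
  | step (F : Set Q.carrier) (f : Q.carrier) : FilterSeq r F → (∃ x, x ≠ ⊥ ∧ x ∉ F) →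
      Maximal (· ∉ F) f → (∀ y, Maximal (· ∉ F) y → y ≠ f → r f y) → FilterSeq r (insert f F)

variable {Q}

theorem leftSeq_iff_filterSeq {X : Set Q.carrier} :
    Q.LeftSeq X ↔ Q.FilterSeq Q.diagram.Lft X := by
  constructor <;> intro h
  · induction h with
    | base => exact .base
    | step F f _ h₁ h₂ h₃ ih => exact .step F f ih h₁ h₂ h₃
  · induction h with
    | base => exact .base
    | step F f _ h₁ h₂ h₃ ih => exact .step F f ih h₁ h₂ h₃

theorem rightSeq_iff_filterSeq {X : Set Q.carrier} :
    Q.RightSeq X ↔ Q.FilterSeq (Function.swap Q.diagram.Lft) X := by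
  constructor <;> intro h
  · induction h with
    | base => exact .base
    | step F f _ h₁ h₂ h₃ ih =>
      exact .step F f ih h₁ h₂ fun y hy hne =>
        (Q.isQuasiplanar.lft_iff_rght _ _).2 (h₃ y hy hne)
  · induction h with
    | base => exact .base
    | step F f _ h₁ h₂ h₃ ih =>
      exact .step F f ih h₁ h₂ fun y hy hne =>
        (Q.isQuasiplanar.lft_iff_rght _ _).1 (h₃ y hy hne)

/-- The sequence runs through the final segments of ≤ ∪ r⁻¹ that avoid ⊥: the r-first maximal
element outside such a segment is the last element outside it in this linear order. -/
theorem filterSeq_iff {r : Q.carrier → Q.carrier → Prop} (hr : IsConjugate r)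
    {X : Set Q.carrier} : Q.FilterSeq r X ↔
      X.Nonempty ∧ ⊥ ∉ X ∧ ∀ x ∈ X, ∀ y, leftLE (Function.swap r) x y → y ∈ X := by
  constructor
  · intro h
    induction h with
    | base =>
      refine ⟨⟨⊤, rfl⟩, fun h => top_ne_bot (Set.mem_singleton_iff.1 h).symm, ?_⟩
      rintro _ rfl y hy
      exact hr.swap.le_antisymm (Or.inl le_top) hy
    | step F f _ h₁ h₂ h₃ ih =>
      refine ⟨⟨f, Set.mem_insert f F⟩, ?_, ?_⟩
      · rintro (h | h)
        · obtain ⟨x, hx, hxF⟩ := h₁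
          exact hx (le_bot_iff.1 (h ▸ h₂.2 hxF (h ▸ bot_le)))
        · exact ih.2.1 h
      · rintro x (rfl | hx) y hy
        · by_contra hyF
          obtain ⟨hne, hyF⟩ := not_or.1 hyF
          -- An element outside is below some maximal m outside; since f is r-first, m is weakly
          -- before f in the linear order, hence so is y.
          obtain ⟨m, hm, hmF⟩ := (Set.toFinite {z | z ∉ F}).exists_le_maximal hyF
          by_cases hmx : m = x
          · subst hmx
            exact hne (hr.swap.le_antisymm (Or.inl hm) hy)
          · have hxm := h₃ m hmF hmx
            exact hne (hr.swap.le_antisymm (hr.swap.le_trans (Or.inl hm) (Or.inr hxm)) hy)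
        · exact Or.inr (ih.2.2 x hx y hy)
  · rintro ⟨hne, hbot, hup⟩
    induction hcard : X.ncard using Nat.strong_induction_on generalizing X with
    | _ n ih =>
    obtain ⟨f, hf, hfX⟩ := hr.swap.exists_least hne
    have htop : ⊤ ∈ X := hup f hf _ (Or.inl le_top)
    by_cases hft : f = ⊤
    · have : X = {⊤} := Set.eq_singleton_iff_unique_mem.2 ⟨htop, fun x hx =>
        hr.swap.le_antisymm (Or.inl le_top) (hft ▸ hfX x hx)⟩
      rw [this]
      exact .base
    have hup' : ∀ x ∈ X \ {f}, ∀ y, leftLE (Function.swap r) x y → y ∈ X \ {f} := by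
      rintro x ⟨hx, hxf⟩ y hy
      refine ⟨hup x hx y hy, ?_⟩
      rintro rfl
      exact hxf (hr.swap.le_antisymm hy (hfX x hx))
    have hne' : (X \ {f}).Nonempty := ⟨⊤, htop, Ne.symm hft⟩
    have hrec : Q.FilterSeq r (X \ {f}) := ih _
      (hcard ▸ Set.ncard_sdiff_singleton_lt_of_mem hf (Set.toFinite X)) hne'
      (fun h => hbot h.1) hup' rfl
    have hfmax : Maximal (· ∉ X \ {f}) f := by
      refine ⟨fun h => h.2 rfl, fun y hy hfy => ?_⟩
      by_contra hyf
      exact hy ⟨hup f hf y (Or.inl hfy), fun h => hyf (Set.mem_singleton_iff.1 h).le⟩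
    rw [← Set.insert_eq_of_mem hf, ← Set.insert_sdiff_singleton]
    refine .step _ f hrec ⟨f, fun h => hbot (h ▸ hf), fun h => h.2 rfl⟩ hfmax fun y hy hyf => ?_
    have hyX : y ∉ X := fun h => hy.1 ⟨h, hyf⟩
    have hlt : leftLE (Function.swap r) y f :=
      (hr.swap.le_total y f).resolve_right fun h => hyX (hup f hf y h)
    exact hlt.resolve_left fun h => hyf (le_antisymm h (hy.2 hfmax.1 h))

theorem exists_val_eq {L : Type*} (e : L ≃ HcoFilter Q) {X : Set Q.carrier}
    (hX : Q.IsHcoFilter X) : ∃ s, (e s).1 = X :=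
  ⟨e.symm ⟨X, hX⟩, congrArg Subtype.val (e.apply_symm_apply ⟨X, hX⟩)⟩

/-- The filters of a sequence form a maximal chain in the lattice of filters. -/
theorem isMaxChain_of_filterSeq {L : Type*} [PartialOrder L] (e : L ≃ HcoFilter Q)
    (he : ∀ s t, s ≤ t ↔ (e t).1 ⊆ (e s).1) {r : Q.carrier → Q.carrier → Prop}
    (hr : IsConjugate r) (hX : ∀ X, Q.FilterSeq r X → Q.IsHcoFilter X) :
    IsMaxChain (· ≤ ·) {s | Q.FilterSeq r (e s).1} := by
  constructor
  · intro s hs t ht _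
    have hs := ((filterSeq_iff hr).1 hs).2.2
    have ht := ((filterSeq_iff hr).1 ht).2.2
    change s ≤ t ∨ t ≤ s
    rw [he, he]
    by_contra! h
    obtain ⟨x, hxt, hxs⟩ := Set.not_subset.1 h.1
    obtain ⟨y, hys, hyt⟩ := Set.not_subset.1 h.2
    rcases hr.swap.le_total x y with hxy | hxy
    · exact hyt (ht x hxt y hxy)
    · exact hxs (hs y hys x hxy)
  · intro E hE hsub
    refine Set.Subset.antisymm hsub fun t ht => ?_
    obtain ⟨y, hy, hyt⟩ := hr.swap.exists_least (e t).2.nonempty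
    refine (filterSeq_iff hr).2 ⟨(e t).2.nonempty, (e t).2.bot_notMem, ?_⟩
    suffices h : ∀ z, leftLE (Function.swap r) y z → z ∈ (e t).1 from
      fun x hx z hz => h z (hr.swap.le_trans (hyt x hx) hz)
    -- If z were missing, the final segment from z, which belongs to E, would be incomparable with
    -- the filter of t: it contains z but not y.
    intro z hz
    by_contra hzt
    have hyz : y ≠ z := fun h => hzt (h ▸ hy)
    have hybot : y ≠ ⊥ := fun h => (e t).2.bot_notMem (h ▸ hy)
    have hU : Q.FilterSeq r {w | leftLE (Function.swap r) z w} := by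
      refine (filterSeq_iff hr).2 ⟨⟨z, Or.inl le_rfl⟩, fun h => ?_, fun x hx w hw =>
        hr.swap.le_trans hx hw⟩
      exact ne_bot_of_leftLE hr.swap hybot (hr.swap.le_trans hz h) rfl
    obtain ⟨u, hu⟩ := exists_val_eq e (hX _ hU)
    rw [← hu] at hU
    rcases hE.total ht (hsub hU) with h | h <;> rw [he, hu] at h
    · exact hzt (h (Or.inl le_rfl))
    · exact hyz (hr.swap.le_antisymm hz (h hy))

theorem isHcoFilter_of_filterSeq_left {X : Set Q.carrier} (h : Q.FilterSeq Q.diagram.Lft X) :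
    Q.IsHcoFilter X := by
  obtain ⟨h₁, h₂, h₃⟩ := (filterSeq_iff Q.isConjugate).1 h
  exact ⟨h₁, h₂, fun x y hxy hx => h₃ x hx y (Or.inl hxy),
    fun x y z _ hyz _ hz => h₃ z hz y (Or.inr hyz)⟩

theorem isHcoFilter_of_filterSeq_right {X : Set Q.carrier}
    (h : Q.FilterSeq (Function.swap Q.diagram.Lft) X) : Q.IsHcoFilter X := by
  obtain ⟨h₁, h₂, h₃⟩ := (filterSeq_iff Q.isConjugate.swap).1 h
  exact ⟨h₁, h₂, fun x y hxy hx => h₃ x hx y (Or.inl hxy),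
    fun x y z hxy _ hx _ => h₃ x hx y (Or.inr hxy)⟩

variable {D : SlimSemimodularDiagram.{u}}

theorem image_eq_of_isHcoFilter (e : D.carrier ≃ HcoFilter Q) {p : Set Q.carrier → Prop}
    (hp : ∀ X, p X → Q.IsHcoFilter X) :
    (fun s => (e s).1) '' {s | p (e s).1} = {X | p X} := by
  ext X
  constructor
  · rintro ⟨s, hs, rfl⟩
    exact hs
  · intro hX
    obtain ⟨s, rfl⟩ := exists_val_eq e (hp X hX)
    exact ⟨s, hX, rfl⟩

theorem _root_.IsMaxChain.exists_incomp {P : Type*} [PartialOrder P] {E : Set P}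
    (hE : IsMaxChain (· ≤ ·) E) {x : P} (hx : x ∉ E) : ∃ y ∈ E, ¬ x ≤ y ∧ ¬ y ≤ x := by
  by_contra! h
  refine hx ?_
  rw [hE.2 (hE.1.insert fun y hy _ => ?_) (Set.subset_insert x E)]
  · exact Set.mem_insert x E
  · by_cases hxy : x ≤ y
    · exact Or.inl hxy
    · exact Or.inr (h y hy hxy)

/-- An element off E is incomparable to some y in E; having nothing on its left, it is on the left
of y, hence of E. -/
theorem _root_.SlimSemimodularDiagram.isLeftBoundary {C : Set D.carrier}
    (hC : IsMaxChain (· ≤ ·) C) (h : ∀ x ∈ C, ∀ y, ¬ D.diagram.Lft y x) :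
    D.diagram.IsLeftBoundary C := by
  have := Fintype.ofFinite D.carrier
  have := Fintype.toBoundedOrder D.carrier
  refine ⟨hC, fun E hE x hx => ?_⟩
  by_cases hxE : x ∈ E
  · exact D.diagram.onLeft_of_mem hxE
  obtain ⟨y, hy, hxy, hyx⟩ := hE.exists_incomp hxE
  exact D.isPlanar.isQuasiplanar.left_of_every x y
    ((D.isConjugate.total hxy hyx).resolve_right (h x hx y)) E hE hy

theorem _root_.SlimSemimodularDiagram.isRightBoundary {C : Set D.carrier}
    (hC : IsMaxChain (· ≤ ·) C) (h : ∀ x ∈ C, ∀ y, ¬ D.diagram.Lft x y) :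
    D.diagram.IsRightBoundary C := by
  have := Fintype.ofFinite D.carrier
  have := Fintype.toBoundedOrder D.carrier
  refine ⟨hC, fun E hE x hx => ?_⟩
  by_cases hxE : x ∈ E
  · exact D.diagram.onRight_of_mem hxE
  obtain ⟨y, hy, hxy, hyx⟩ := hE.exists_incomp hxE
  exact (D.diagram.onLeft_or_onRight hE x).resolve_left fun hl => h x hx y ⟨hxy, hyx, E, hE, hy, hl⟩

theorem IsBetaOne.isBetaTwo (h : Q.IsBetaOne D) : Q.IsBetaTwo D := by
  obtain ⟨e, hle, hlft⟩ := h
  let e' := e.trans LeftPair.filterEquiv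
  have he' : ∀ s t, s ≤ t ↔ (e' t).1 ⊆ (e' s).1 := fun s t =>
    (hle s t).trans LeftPair.le_iff_filter_subset
  refine ⟨e', he', ⟨{s | Q.LeftSeq (e' s).1}, ?_, image_eq_of_isHcoFilter e' fun X hX =>
      isHcoFilter_of_filterSeq_left (leftSeq_iff_filterSeq.1 hX)⟩,
    ⟨{s | Q.RightSeq (e' s).1}, ?_, image_eq_of_isHcoFilter e' fun X hX =>
      isHcoFilter_of_filterSeq_right (rightSeq_iff_filterSeq.1 hX)⟩⟩
  · simp only [leftSeq_iff_filterSeq]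
    refine SlimSemimodularDiagram.isLeftBoundary (isMaxChain_of_filterSeq e' he' Q.isConjugate
      fun X => isHcoFilter_of_filterSeq_left) fun s hs t hts => ?_
    have hup := ((filterSeq_iff Q.isConjugate).1 hs).2.2
    rw [hlft, LeftPair.lft_iff] at hts
    obtain ⟨⟨h₁, h₂⟩, h₃, -⟩ := hts
    exact h₂ (Q.isConjugate.le_antisymm h₁ (hup _ (e s).snd_mem_filter _
      (Q.isConjugate.swap.le_trans h₃ (e t).leftLE_snd_fst)).1)
  · simp only [rightSeq_iff_filterSeq]
    refine SlimSemimodularDiagram.isRightBoundary (isMaxChain_of_filterSeq e' he'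
      Q.isConjugate.swap fun X => isHcoFilter_of_filterSeq_right) fun s hs t hst => ?_
    have hup := ((filterSeq_iff Q.isConjugate.swap).1 hs).2.2
    rw [hlft, LeftPair.lft_iff] at hst
    obtain ⟨⟨h₁, -⟩, h₃, h₄⟩ := hst
    exact h₄ (Q.isConjugate.swap.le_antisymm h₃ (hup _ (e s).fst_mem_filter _
      (Q.isConjugate.le_trans h₁ (e t).leftLE_fst_snd)).2)

theorem IsBetaTwo.isBetaOne (h : Q.IsBetaTwo D) : Q.IsBetaOne D := by
  obtain ⟨e, hle, ⟨C, hC, himage⟩, -⟩ := h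
  have := Fintype.ofFinite D.carrier
  have := Fintype.toBoundedOrder D.carrier
  let g := e.trans LeftPair.filterEquiv.symm
  have hg : ∀ s, (g s).filter = (e s).1 := fun s => LeftPair.filter_filterEquiv_symm _
  have hgle : ∀ s t, s ≤ t ↔ g s ≤ g t := fun s t => by
    rw [LeftPair.le_iff_filter_subset, hg, hg, hle]
  have himp : ∀ s t : LeftPair Q, s.lft t → D.diagram.Lft (g.symm s) (g.symm t) := by
    intro s t hst
    obtain ⟨d, rfl⟩ := g.surjective s
    obtain ⟨d', rfl⟩ := g.surjective t
    rw [g.symm_apply_apply, g.symm_apply_apply]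
    obtain ⟨h₁, h₂⟩ := (LeftPair.isConjugate_lft Q).incomp hst
    rw [← hgle] at h₁ h₂
    refine (D.isConjugate.total h₁ h₂).resolve_right fun hd => ?_
    obtain ⟨-, h₃, h₄⟩ := LeftPair.lft_iff.1 hst
    -- The final segment from the second component for d gives l on the left boundary with l ≤ d but
    -- not l ≤ d'. So l λ d', and d' λ d would yield l λ d, against l ≤ d.
    have hU : Q.LeftSeq {w | leftLE (Function.swap Q.diagram.Lft) (g d).1.2 w} :=
      leftSeq_iff_filterSeq.2 ((filterSeq_iff Q.isConjugate).2 ⟨⟨_, Or.inl le_rfl⟩,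
        fun h => ne_bot_of_leftLE Q.isConjugate.swap (g d).2.2.1 h rfl,
        fun x hx w hw => Q.isConjugate.swap.le_trans hx hw⟩)
    obtain ⟨l, hlC, hl⟩ := himage.ge hU
    change (e l).1 = _ at hl
    have hld : l ≤ d := by
      rw [hle, hl, ← hg]
      exact fun w hw => hw.2
    have hld' : ¬ l ≤ d' := by
      rw [hle, hl, ← hg]
      exact fun h => h₄ (Q.isConjugate.swap.le_antisymm h₃ (h (g d').snd_mem_filter))
    obtain ⟨E, hE, hd'E⟩ := HasseDiagram.exists_isMaxChain_mem d'
    have hlft : D.diagram.Lft l d' :=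
      ⟨hld', fun h => h₂ (h.trans hld), E, hE, hd'E, hC.2 E hE l hlC⟩
    exact (D.isConjugate.incomp (D.isConjugate.trans hlft hd)).1 hld
  refine ⟨g, hgle, fun s t => ?_⟩
  have := (LeftPair.isConjugate_lft Q).rel_iff_of_imp D.isConjugate g.symm
    (fun s t => by rw [hgle, g.apply_symm_apply, g.apply_symm_apply]) himp (g s) (g t)
  rw [this, g.symm_apply_apply, g.symm_apply_apply]

theorem isBetaTwo_iff : Q.IsBetaTwo D ↔ D.IsAlpha Q :=
  ⟨fun h => h.isBetaOne.isAlpha, fun h => h.isBetaOne.isBetaTwo⟩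

end QuasiplanarDiagram

/-! ### The bijection of similarity classes -/

/-- As α and β are given only up to similarity, they are relations rather than functions; this turns
such a relation into a bijection of classes. -/
theorem Setoid.exists_quotient_equiv {α β : Type*} {s : Setoid α} {t : Setoid β}
    {R : α → β → Prop} (hα : ∀ a, ∃ b, R a b) (hβ : ∀ b, ∃ a, R a b)
    (h₁ : ∀ {a a' b}, R a b → R a' b → s a a') (h₂ : ∀ {a b b'}, R a b → R a b' → t b b')
    (h₃ : ∀ {a a' b}, s a a' → R a b → R a' b) (h₄ : ∀ {a b b'}, R a b → t b b' → R a b') :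
    ∃ A : Quotient s ≃ Quotient t, ∀ a b, A (Quotient.mk s a) = Quotient.mk t b ↔ R a b := by
  choose f hf using hα
  choose g hg using hβ
  refine ⟨⟨Quotient.map f fun a a' h => h₂ (h₃ h (hf a)) (hf a'),
    Quotient.map g fun b b' h => h₁ (h₄ (hg b) h) (hg b'), ?_, ?_⟩, fun a b => ?_⟩
  · rintro ⟨a⟩
    exact Quotient.sound (h₁ (hg (f a)) (hf a))
  · rintro ⟨b⟩
    exact Quotient.sound (h₂ (hf (g b)) (hg b))
  · exact Quotient.eq.trans ⟨fun h => h₄ (hf a) h, fun h => h₂ (hf a) h⟩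

theorem theorem1 (IsBeta : QuasiplanarDiagram.{u} → SlimSemimodularDiagram.{u} → Prop)
    (hBeta : IsBeta = QuasiplanarDiagram.IsBetaOne ∨ IsBeta = QuasiplanarDiagram.IsBetaTwo) :
    (∀ D : SlimSemimodularDiagram.{u}, ∃ Q : QuasiplanarDiagram.{u}, D.IsAlpha Q) ∧
    (∀ Q : QuasiplanarDiagram.{u}, ∃ D : SlimSemimodularDiagram.{u}, IsBeta Q D) ∧
    (∀ (D : SlimSemimodularDiagram.{u}) (Q : QuasiplanarDiagram.{u})
      (D' : SlimSemimodularDiagram.{u}),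
      D.IsAlpha Q → IsBeta Q D' → SlimSemimodularDiagram.similar D' D) ∧
    (∀ (Q : QuasiplanarDiagram.{u}) (D : SlimSemimodularDiagram.{u})
      (Q' : QuasiplanarDiagram.{u}),
      IsBeta Q D → D.IsAlpha Q' → QuasiplanarDiagram.similar Q' Q) ∧
    (∃ A : Quotient SlimSemimodularDiagram.similar.{u} ≃ Quotient QuasiplanarDiagram.similar.{u},
      (∀ (D : SlimSemimodularDiagram.{u}) (Q : QuasiplanarDiagram.{u}),
        A (Quotient.mk _ D) = Quotient.mk _ Q ↔ D.IsAlpha Q) ∧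
      (∀ (Q : QuasiplanarDiagram.{u}) (D : SlimSemimodularDiagram.{u}),
        A.symm (Quotient.mk _ Q) = Quotient.mk _ D ↔ IsBeta Q D)) := by
  have hiff : ∀ Q D, IsBeta Q D ↔ D.IsAlpha Q := by
    rcases hBeta with rfl | rfl
    · exact fun _ _ => QuasiplanarDiagram.isBetaOne_iff
    · exact fun _ _ => QuasiplanarDiagram.isBetaTwo_iff
  have hex : ∀ Q : QuasiplanarDiagram.{u}, ∃ D : SlimSemimodularDiagram.{u}, D.IsAlpha Q :=
    fun Q => Q.exists_isBetaOne.imp fun _ h => h.isAlpha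
  have huniq : ∀ {D D' : SlimSemimodularDiagram.{u}} {Q : QuasiplanarDiagram.{u}},
      D.IsAlpha Q → D'.IsAlpha Q → SlimSemimodularDiagram.similar D D' :=
    fun h h' => h.isBetaOne.similar h'.isBetaOne
  refine ⟨SlimSemimodularDiagram.exists_isAlpha, fun Q => ?_, fun D Q D' h h' => ?_,
    fun Q D Q' h h' => ?_, ?_⟩
  · exact (hex Q).imp fun D h => (hiff Q D).2 h
  · exact huniq ((hiff Q D').1 h') h
  · exact h'.similar ((hiff Q D).1 h)
  · obtain ⟨A, hA⟩ := Setoid.exists_quotient_equiv (s := SlimSemimodularDiagram.similar.{u})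
      (t := QuasiplanarDiagram.similar.{u}) (R := SlimSemimodularDiagram.IsAlpha)
      SlimSemimodularDiagram.exists_isAlpha hex huniq (fun h h' => h.similar h')
      (fun h h' => (h'.isBetaOne.trans_similar (Setoid.symm' _ h)).isAlpha)
      fun h h' => h.trans_similar h'
    refine ⟨A, hA, fun Q D => ?_⟩
    rw [hiff, ← hA, A.symm_apply_eq, eq_comm]
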